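/- Let $k$ be a field and let $G$ be a finite simple chordal graph on $n$ vertices (every cycle of length $>3$ has a chord). Let $\Delta=\Delta(G)$ be its clique complex, whose faces are the cliques of $G$ including the empty one, let $d=\dim(\Delta)+1$, let $R=k[x_1,\dots,x_n]$ (one variable for each vertex), and let $k[\Delta]=R/I(\Delta)$ be the Stanley--Reisner ring, where $I(\Delta)$ is generated by the monomials $\prod_{j\in F}x_j$ with $F\notin\Delta$. Let $f_{i-1}$ be the number of faces of $\Delta$ with $i$ vertices, and define the $h$-vector of $\Delta$ by $\sum_j h_jt^j=\sum_{i=0}^{d} f_{i-1}t^i(1-t)^{d-i}$, so that $h_j=0$ for $j>d$. Then $k[\Delta]$ has a minimal graded free resolution over $R$, and every such resolution has the $2$-linear form $$\cdots\longrightarrow R(-2-i)^{\beta_i}\longrightarrow\cdots\longrightarrow R(-3)^{\beta_1}\longrightarrow R(-2)^{\beta_0}\longrightarrow R\longrightarrow k[\Delta]\longrightarrow 0 ,$$ with nonzero free modules exactly in the homological degrees $0,1,\dots,\operatorname{pd}_R k[\Delta]$ (here $R$ stands in degree $0$ and $R(-2-i)^{\beta_i}$ in degree $i+1$). Moreover,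 for every $i\ge 0$, $$\beta_i=\sum_{\ell=0}^{2+i}(-1)^{\ell+i+1}\,h_{2+i-\ell}\binom{n-d}{\ell}.$$ -/

import Mathlib

open scoped BigOperators

namespace ChordalBetti

universe u v

/-- A graph is chordal if every cycle of length greater than three has a chord: an edge of the
graph that joins two vertices of the cycle and is not an edge of the cycle. -/
def IsChordal {V : Type v} (G : SimpleGraph V) : Prop :=
  ∀ (w : V) (c : G.Walk w w), c.IsCycle → 3 < c.length →
    ∃ x ∈ c.support, ∃ y ∈ c.support, G.Adj x y ∧ s(x, y) ∉ c.edges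

/-- The clique complex of a graph. In Mathlib the faces of a simplicial complex are nonempty by
convention; the empty face is added in `IsFace`. -/
def cliqueComplex {V : Type v} (G : SimpleGraph V) : AbstractSimplicialComplex V where
  faces := {s | s.Nonempty ∧ G.IsClique (s : Set V)}
  isRelLowerSet_faces := fun {_} hs =>
    ⟨hs.1, fun _ hts ht => ⟨ht, hs.2.subset (Finset.coe_subset.mpr hts)⟩⟩
  singleton_mem := fun w => ⟨Finset.singleton_nonempty w, by simp⟩

section Complex

variable {V : Type v}

/-- Faces of `Δ`, the empty face included. -/
def IsFace (Δ : AbstractSimplicialComplex V) (s : Finset V) : Prop :=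
  s = ∅ ∨ s ∈ Δ.faces

open Classical in
/-- The finite set of all faces of `Δ`, the empty face included. -/
noncomputable def allFaces [Fintype V] (Δ : AbstractSimplicialComplex V) : Finset (Finset V) :=
  Finset.univ.filter (fun s => IsFace Δ s)

/-- `numFaces Δ i` is the number of faces with `i` vertices, that is, `f_{i-1}(Δ)`. -/
noncomputable def numFaces [Fintype V] (Δ : AbstractSimplicialComplex V) (i : ℕ) : ℕ :=
  ((allFaces Δ).filter (fun s => s.card = i)).card

/-- `d = dim Δ + 1`, the largest number of vertices of a face. -/
noncomputable def dimAddOne [Fintype V] (Δ : AbstractSimplicialComplex V) : ℕ :=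
  (allFaces Δ).sup Finset.card

open Polynomial in
/-- The polynomial `∑ h_j t^j = ∑_{i=0}^d f_{i-1} t^i (1-t)^{d-i}`. -/
noncomputable def hPolynomial [Fintype V] (Δ : AbstractSimplicialComplex V) : ℤ[X] :=
  ∑ i ∈ Finset.range (dimAddOne Δ + 1),
    C (numFaces Δ i : ℤ) * X ^ i * (1 - X) ^ (dimAddOne Δ - i)

/-- The entry `h_j` of the `h`-vector of `Δ` (zero for `j > d`). -/
noncomputable def hVector [Fintype V] (Δ : AbstractSimplicialComplex V) (j : ℕ) : ℤ :=
  (hPolynomial Δ).coeff j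

/-- The Stanley-Reisner ideal: generated by the squarefree monomials of the non-faces. -/
noncomputable def stanleyReisnerIdeal (k : Type u) [Field k] (Δ : AbstractSimplicialComplex V) :
    Ideal (MvPolynomial V k) :=
  Ideal.span {f | ∃ s : Finset V, ¬ IsFace Δ s ∧ f = ∏ j ∈ s, MvPolynomial.X j}

/-- The Stanley-Reisner ring `k[Δ]`, as a quotient of the polynomial ring. -/
abbrev StanleyReisnerRing (k : Type u) [Field k] (Δ : AbstractSimplicialComplex V) :
    Type (max u v) :=
  MvPolynomial V k ⧸ stanleyReisnerIdeal k Δ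

end Complex

section Resolution

variable {k : Type u} [Field k] {V : Type v}

/-- With `R = k[x_v : v ∈ V]`: the vector `x` is homogeneous of degree `e` in the graded free
module `⊕_l R(-a l)`, whose basis vector with index `l` has degree `a l`. -/
def IsHomogeneousVec {b : ℕ} (a : Fin b → ℕ) (e : ℕ) (x : Fin b → MvPolynomial V k) : Prop :=
  ∀ l, ∀ m ∈ (x l).support, a l + Finsupp.degree m = e

/-- The element `y` of `R ⧸ I` is the class of a homogeneous polynomial of degree `e`. -/
def IsHomogeneousClass (I : Ideal (MvPolynomial V k)) (e : ℕ) (y : MvPolynomial V k ⧸ I) : Prop :=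
  ∃ f : MvPolynomial V k, f.IsHomogeneous e ∧ Ideal.Quotient.mk I f = y

/-- A minimal graded free resolution
`⋯ → F_2 → F_1 → F_0 → R ⧸ I → 0` over `R = k[x_v : v ∈ V]`, with
`F_i = ⊕_{j < rank i} R(-shift i j)` of finite rank and all maps homogeneous of degree zero. -/
structure MinimalGradedFreeResolution (I : Ideal (MvPolynomial V k)) where
  /-- the `i`-th total Betti number of `R ⧸ I` -/
  rank : ℕ → ℕ
  /-- the degrees of the basis vectors of `F_i` -/
  shift : ∀ i, Fin (rank i) → ℕ
  /-- the map `F_{i+1} → F_i` -/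
  d : ∀ i, (Fin (rank (i + 1)) → MvPolynomial V k) →ₗ[MvPolynomial V k]
    (Fin (rank i) → MvPolynomial V k)
  /-- the augmentation `F_0 → R ⧸ I` -/
  aug : (Fin (rank 0) → MvPolynomial V k) →ₗ[MvPolynomial V k] (MvPolynomial V k ⧸ I)
  d_homogeneous : ∀ i e x, IsHomogeneousVec (shift (i + 1)) e x →
    IsHomogeneousVec (shift i) e (d i x)
  aug_homogeneous : ∀ e x, IsHomogeneousVec (shift 0) e x → IsHomogeneousClass I e (aug x)
  aug_surjective : Function.Surjective aug
  exact_aug : Function.Exact (d 0) aug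
  exact_d : ∀ i, Function.Exact (d (i + 1)) (d i)
  /-- minimality: the image of `F_{i+1}` lies in `𝔪 F_i`, where `𝔪` is generated by the
  variables -/
  minimal : ∀ i x l, MvPolynomial.constantCoeff (d i x l) = 0

/-- The resolution has the form
`⋯ → R(-t-1)^{β_1} → R(-t)^{β_0} → R → R ⧸ I → 0`. -/
def MinimalGradedFreeResolution.IsLinear {I : Ideal (MvPolynomial V k)}
    (F : MinimalGradedFreeResolution I) (t : ℕ) : Prop :=
  F.rank 0 = 1 ∧ (∀ j, F.shift 0 j = 0) ∧ ∀ i j, F.shift (i + 1) j = t + i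

end Resolution

end ChordalBetti

/-! The ideal of a clique complex is generated by the products of two nonadjacent vertices, and its
resolution is shown to be linear by deleting vertices one at a time. By Dirac's theorem
(`IsChordal.exists_simplicial`) every nonempty vertex set S of a chordal graph contains a vertex w
whose neighbours in S form a clique. Let J be the nonedge ideal of S minus w, and P the ideal
generated by the vertices of S minus w that are not adjacent to w. The nonedge ideal of S is J + wP.
Simpliciality of w gives J ⊆ P, and w is a nonzerodivisor modulo J, so 0 → J(-1) → J ⊕ P(-1) → J +
wP → 0 is exact. A horseshoe argument and a mapping cone argument carry linearity from J and P to J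
+ wP (`HasLinearResolution.sup_span_X_mul`).

Linearity of syzygies does not depend on the chosen minimal generators
(`HasLinearSyzygies.ker_of_minimal`, a form of graded Nakayama). This yields both the existence of a
minimal resolution and the shape of every one. A minimal cover of a projective module is an
isomorphism, so dimension shifting locates the last nonzero module at the projective dimension.

For a linear resolution the Hilbert series determines the ranks: rank-nullity in each degree gives
B_i + X B_{i+1} = β_i, where B_i is the normalised Hilbert series of the i-th syzygy module times
(1-X)^n. Hence the β_i are, up to sign, the coefficients of B_0, and B_0 is read off from X^2 B_0 =
1 - (1-X)^{n-d} h(X), obtained by counting monomials by their supports. -/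

namespace ChordalBetti

universe u v

/-! ### Linear syzygies in short exact sequences -/

section LinearSyzygies

variable {k : Type u} [Field k] {V : Type v}

open MvPolynomial

/-- A family of subgroups of a module over the polynomial ring that is compatible with the grading
of the ring and independent. (It need not span the module.) -/
structure IsGraded (k : Type u) [Field k] (V : Type v) {M : Type*} [AddCommGroup M]
    [Module (MvPolynomial V k) M] (𝓜 : ℕ → AddSubgroup M) : Prop where
  smul_mem : ∀ {i j : ℕ} {r : MvPolynomial V k} {m : M},
    r.IsHomogeneous i → m ∈ 𝓜 j → r • m ∈ 𝓜 (i + j)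
  eq_zero : ∀ (S : Finset ℕ) (m : ℕ → M), (∀ e, m e ∈ 𝓜 e) → ∑ e ∈ S, m e = 0 →
    ∀ e ∈ S, m e = 0

/-- Vectors of polynomials, with those whose coordinates have degree `e + t` in degree `e`. -/
noncomputable def vecGrading (k : Type u) [Field k] (V : Type v) (ι : Type*) (t : ℕ) :
    ℕ → AddSubgroup (ι → MvPolynomial V k) := fun e =>
  { carrier := {x | ∀ i, (x i).IsHomogeneous (e + t)}
    add_mem' := fun ha hb i => (ha i).add (hb i)
    zero_mem' := fun _ => isHomogeneous_zero _ _ _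
    neg_mem' := fun ha i => (ha i).neg }

/-- Polynomials, with those of degree `e + t` in degree `e`. -/
noncomputable def polyGrading (k : Type u) [Field k] (V : Type v) (t : ℕ) :
    ℕ → AddSubgroup (MvPolynomial V k) :=
  fun e => (homogeneousSubmodule V k (e + t)).toAddSubgroup

theorem mem_polyGrading {t e : ℕ} {x : MvPolynomial V k} :
    x ∈ polyGrading k V t e ↔ x.IsHomogeneous (e + t) := Iff.rfl

/-- The grading induced on a submodule. -/
noncomputable def subGrading {M : Type*} [AddCommGroup M] [Module (MvPolynomial V k) M]
    (K : Submodule (MvPolynomial V k) M) (𝓜 : ℕ → AddSubgroup M) : ℕ → AddSubgroup K :=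
  fun e => (𝓜 e).comap K.subtype.toAddMonoidHom

/-- The first `s` steps of a resolution of `M` by finite free modules, with generators in degree
zero and linear differentials, exist. -/
def HasLinearSyzygies (k : Type u) [Field k] (V : Type v) :
    ℕ → ∀ {M : Type (max u v)} [AddCommGroup M] [Module (MvPolynomial V k) M],
      (ℕ → AddSubgroup M) → Prop
  | 0, _, _, _, _ => True
  -- The offset 1 in `vecGrading` encodes linearity: the syzygies must in turn be generated by
  -- vectors of linear forms.
  | s + 1, M, _, _, 𝓜 => ∃ (ι : Type) (_ : Fintype ι) (g : ι → M), (∀ i, g i ∈ 𝓜 0) ∧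
      Submodule.span (MvPolynomial V k) (Set.range g) = ⊤ ∧
      HasLinearSyzygies k V s
        (subGrading (LinearMap.ker (Fintype.linearCombination (MvPolynomial V k) g))
          (vecGrading k V ι 1))

theorem mem_ker_linearCombination {M : Type*} [AddCommGroup M] [Module (MvPolynomial V k) M]
    {ι : Type*} [Fintype ι] {g : ι → M} {x : ι → MvPolynomial V k} :
    x ∈ LinearMap.ker (Fintype.linearCombination (MvPolynomial V k) g) ↔ ∑ i, x i • g i = 0 := by
  rw [LinearMap.mem_ker, Fintype.linearCombination_apply]

theorem exists_sum_smul_eq {M : Type*} [AddCommGroup M] [Module (MvPolynomial V k) M]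
    {ι : Type*} [Fintype ι] {g : ι → M}
    (h : Submodule.span (MvPolynomial V k) (Set.range g) = ⊤) (m : M) :
    ∃ r : ι → MvPolynomial V k, ∑ i, r i • g i = m := by
  have : m ∈ LinearMap.range (Fintype.linearCombination (MvPolynomial V k) g) := by
    rw [Fintype.range_linearCombination, h]; trivial
  exact this

theorem sum_range_homogeneousComponent (p : MvPolynomial V k) {D : ℕ} (hD : p.totalDegree < D) :
    ∑ n ∈ Finset.range D, homogeneousComponent n p = p := by
  conv_rhs => rw [← sum_homogeneousComponent p]
  symm
  apply Finset.sum_subset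
  · intro n hn
    simp only [Finset.mem_range] at *
    omega
  · intro n _ hn
    apply homogeneousComponent_eq_zero
    simp only [Finset.mem_range] at hn
    omega

theorem isGraded_polyGrading (t : ℕ) : IsGraded k V (polyGrading k V t) where
  smul_mem := by
    intro i j r m hr hm
    rw [mem_polyGrading] at *
    rw [add_assoc]
    exact hr.mul hm
  eq_zero := by
    intro S m hm h e he
    have := congrArg (homogeneousComponent (e + t)) h
    rw [map_sum, map_zero, Finset.sum_eq_single e] at this
    · rwa [homogeneousComponent_of_mem (hm e), if_pos rfl] at this
    · intro b _ hb
      rw [homogeneousComponent_of_mem (hm b), if_neg (by omega)]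
    · exact fun h => (h he).elim

theorem isGraded_vecGrading (ι : Type*) (t : ℕ) : IsGraded k V (vecGrading k V ι t) where
  smul_mem := by
    intro i j r m hr hm l
    exact (isGraded_polyGrading t).smul_mem hr (hm l)
  eq_zero := by
    intro S m hm h e he
    funext l
    refine (isGraded_polyGrading (k := k) (V := V) t).eq_zero S (fun e => m e l)
      (fun e => hm e l) ?_ e he
    simpa using congrFun h l

section

variable {M : Type*} [AddCommGroup M] [Module (MvPolynomial V k) M] {𝓜 : ℕ → AddSubgroup M}

theorem IsGraded.subGrading (h : IsGraded k V 𝓜) (K : Submodule (MvPolynomial V k) M) :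
    IsGraded k V (subGrading K 𝓜) where
  smul_mem := fun hr hm => h.smul_mem hr hm
  eq_zero := by
    intro S m hm hs e he
    apply Subtype.ext
    refine h.eq_zero S (fun e => (m e : M)) hm ?_ e he
    simpa using congrArg (Subtype.val) hs

theorem IsGraded.prod {N : Type*} [AddCommGroup N] [Module (MvPolynomial V k) N]
    {𝓝 : ℕ → AddSubgroup N} (h : IsGraded k V 𝓜) (h' : IsGraded k V 𝓝) :
    IsGraded k V (fun e => (𝓜 e).prod (𝓝 e)) where
  smul_mem := fun hr hm => ⟨h.smul_mem hr hm.1, h'.smul_mem hr hm.2⟩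
  eq_zero := by
    intro S m hm hs e he
    apply Prod.ext
    · refine h.eq_zero S (fun e => (m e).1) (fun e => (hm e).1) ?_ e he
      simpa [Prod.fst_sum] using congrArg Prod.fst hs
    · refine h'.eq_zero S (fun e => (m e).2) (fun e => (hm e).2) ?_ e he
      simpa [Prod.snd_sum] using congrArg Prod.snd hs

/-- Splitting the coefficients into homogeneous components splits the sum into pieces of distinct
degrees; by independence only the piece of degree `e` survives. -/
theorem IsGraded.sum_homogeneousComponent_smul (h : IsGraded k V 𝓜) {ι : Type*} [Fintype ι]
    {g : ι → M} (hg : ∀ i, g i ∈ 𝓜 0) (r : ι → MvPolynomial V k) {e : ℕ}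
    (he : ∑ i, r i • g i ∈ 𝓜 e) :
    ∑ i, homogeneousComponent e (r i) • g i = ∑ i, r i • g i := by
  classical
  obtain ⟨D, hD⟩ : ∃ D, e < D ∧ ∀ i, (r i).totalDegree < D := by
    refine ⟨e + ∑ i, (r i).totalDegree + 1, by omega, fun i => ?_⟩
    have := Finset.single_le_sum (f := fun i => (r i).totalDegree) (fun _ _ => Nat.zero_le _)
      (Finset.mem_univ i)
    omega
  have hsum : ∑ n ∈ Finset.range D, ∑ i, homogeneousComponent n (r i) • g i
      = ∑ i, r i • g i := by
    rw [Finset.sum_comm]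
    refine Finset.sum_congr rfl fun i _ => ?_
    rw [← Finset.sum_smul, sum_range_homogeneousComponent _ (hD.2 i)]
  have hm : ∀ n, ∑ i, homogeneousComponent n (r i) • g i ∈ 𝓜 n := fun n =>
    AddSubgroup.sum_mem _ fun i _ => by
      simpa using h.smul_mem (homogeneousComponent_isHomogeneous n (r i)) (hg i)
  -- Independence is applied to the family of pieces with the whole sum subtracted in degree `e`;
  -- this family adds up to zero.
  have := h.eq_zero (Finset.range D)
    (fun n => ∑ i, homogeneousComponent n (r i) • g i - if n = e then ∑ i, r i • g i else 0)
    (fun n => by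
      refine AddSubgroup.sub_mem _ (hm n) ?_
      split_ifs with hn
      · rw [hn]; exact he
      · exact AddSubgroup.zero_mem _)
    (by
      rw [Finset.sum_sub_distrib, hsum, Finset.sum_ite_eq' (Finset.range D) e,
        if_pos (Finset.mem_range.2 hD.1), sub_self]) e (Finset.mem_range.2 hD.1)
  simpa [sub_eq_zero] using this

theorem IsGraded.exists_homogeneous_coeff (h : IsGraded k V 𝓜) {ι : Type*} [Fintype ι]
    {g : ι → M} (hg : ∀ i, g i ∈ 𝓜 0)
    (hspan : Submodule.span (MvPolynomial V k) (Set.range g) = ⊤) {e : ℕ} {m : M} (hm : m ∈ 𝓜 e) :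
    ∃ r : ι → MvPolynomial V k, (∀ i, (r i).IsHomogeneous e) ∧ ∑ i, r i • g i = m := by
  obtain ⟨r, rfl⟩ := exists_sum_smul_eq hspan m
  exact ⟨fun i => homogeneousComponent e (r i), fun i => homogeneousComponent_isHomogeneous _ _,
    h.sum_homogeneousComponent_smul hg r hm⟩

end

section

variable {A B C : Type (max u v)} [AddCommGroup A] [AddCommGroup B] [AddCommGroup C]
  [Module (MvPolynomial V k) A] [Module (MvPolynomial V k) B] [Module (MvPolynomial V k) C]
  {𝒜 : ℕ → AddSubgroup A} {ℬ : ℕ → AddSubgroup B} {𝒞 : ℕ → AddSubgroup C}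

/-- Only degree zero has to be respected: beyond the generators, the definition refers to the
grading of the free module and no longer to that of the module itself. -/
theorem HasLinearSyzygies.of_linearEquiv (φ : A ≃ₗ[MvPolynomial V k] B)
    (hφ : ∀ a ∈ 𝒜 0, φ a ∈ ℬ 0) {s : ℕ} (h : HasLinearSyzygies k V s 𝒜) :
    HasLinearSyzygies k V s ℬ := by
  cases s with
  | zero => trivial
  | succ s =>
    obtain ⟨ι, _, g, hg, hspan, hs⟩ := h
    refine ⟨ι, inferInstance, φ ∘ g, fun i => hφ _ (hg i), ?_, ?_⟩
    · rw [Set.range_comp, ← LinearEquiv.coe_coe, ← Submodule.map_span, hspan, Submodule.map_top,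
        LinearEquiv.range]
    · have : LinearMap.ker (Fintype.linearCombination (MvPolynomial V k) (φ ∘ g)) =
          LinearMap.ker (Fintype.linearCombination (MvPolynomial V k) g) := by
        ext x
        simp only [LinearMap.mem_ker, Fintype.linearCombination_apply, Function.comp_apply,
          ← map_smul, ← map_sum, LinearEquiv.map_eq_zero_iff]
      rw [this]
      exact hs

theorem HasLinearSyzygies.of_subsingleton [Subsingleton A] (s : ℕ) :
    HasLinearSyzygies k V s 𝒜 := by
  induction s generalizing A with
  | zero => trivial
  | succ s ih =>
    exact ⟨Empty, inferInstance, Empty.elim, fun i => i.elim, Subsingleton.elim _ _, ih⟩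

theorem HasLinearSyzygies.of_succ {s : ℕ} (h : HasLinearSyzygies k V (s + 1) 𝒜) :
    HasLinearSyzygies k V s 𝒜 := by
  induction s generalizing A with
  | zero => trivial
  | succ s ih =>
    obtain ⟨ι, _, g, hg, hspan, hs⟩ := h
    exact ⟨ι, inferInstance, g, hg, hspan, ih hs⟩

/-- Extensions by zero of syzygies. -/
noncomputable def kerInl {ι κ : Type} [Fintype ι] [Fintype κ] (f : A →ₗ[MvPolynomial V k] B) (g : ι → A)
    (b : κ → B) :
    LinearMap.ker (Fintype.linearCombination (MvPolynomial V k) g) →ₗ[MvPolynomial V k]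
      LinearMap.ker (Fintype.linearCombination (MvPolynomial V k) (Sum.elim (f ∘ g) b)) where
  toFun x := ⟨Sum.elim x.1 0, by
    have := congrArg f (mem_ker_linearCombination.1 x.2)
    simpa [Fintype.linearCombination_apply] using this⟩
  map_add' x y := by ext (i | i) <;> simp
  map_smul' r x := by ext (i | i) <;> simp

/-- Restriction of syzygies to a block of generators. -/
noncomputable def kerInr {ι κ : Type} [Fintype ι] [Fintype κ] (g : B →ₗ[MvPolynomial V k] C) (a : ι → B)
    (b : κ → B) (ha : ∀ i, g (a i) = 0) :
    LinearMap.ker (Fintype.linearCombination (MvPolynomial V k) (Sum.elim a b))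
      →ₗ[MvPolynomial V k]
      LinearMap.ker (Fintype.linearCombination (MvPolynomial V k) (g ∘ b)) where
  toFun x := ⟨x.1 ∘ Sum.inr, by
    have := congrArg g (mem_ker_linearCombination.1 x.2)
    simpa [Fintype.linearCombination_apply, ha] using this⟩
  map_add' x y := by ext i; simp
  map_smul' r x := by ext i; simp

/-- Horseshoe lemma. Generators of `A` and lifts of generators of `C` together generate `B`, and the
three syzygy modules again form a short exact sequence. The two degree conditions are inherited by
that sequence, which makes the induction run. -/
theorem HasLinearSyzygies.extension (hA : IsGraded k V 𝒜) (hB : IsGraded k V ℬ)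
    {f : A →ₗ[MvPolynomial V k] B} {g : B →ₗ[MvPolynomial V k] C} (hf : Function.Injective f)
    (hg : Function.Surjective g) (hfg : Function.Exact f g)
    (hfdeg : ∀ e a, f a ∈ ℬ e ↔ a ∈ 𝒜 e)
    (hglift : ∀ e, ∀ c ∈ 𝒞 e, ∃ b ∈ ℬ e, g b = c) {s : ℕ}
    (h : HasLinearSyzygies k V s 𝒜) (h' : HasLinearSyzygies k V s 𝒞) :
    HasLinearSyzygies k V s ℬ := by
  induction s generalizing A B C with
  | zero => trivial
  | succ s ih =>
    obtain ⟨ι, _, a, ha, haspan, hs⟩ := h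
    obtain ⟨κ, _, c, hc, hcspan, hs'⟩ := h'
    choose b hb hbc using fun i => hglift 0 (c i) (hc i)
    obtain rfl : g ∘ b = c := funext hbc
    have hga : ∀ i, g ((f ∘ a) i) = 0 := fun i => hfg.apply_apply_eq_zero _
    have haspan' := exists_sum_smul_eq haspan
    have hcspan' := exists_sum_smul_eq hcspan
    refine ⟨ι ⊕ κ, inferInstance, Sum.elim (f ∘ a) b, ?_, ?_, ?_⟩
    · rintro (i | i)
      · exact (hfdeg 0 _).2 (ha i)
      · exact hb i
    · rw [← Fintype.range_linearCombination, LinearMap.range_eq_top]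
      intro y
      obtain ⟨r, hr⟩ := hcspan' (g y)
      obtain ⟨x, hx⟩ := (hfg (y - ∑ i, r i • b i)).1 (by
        rw [map_sub, map_sum, sub_eq_zero, ← hr]
        simp)
      obtain ⟨q, rfl⟩ := haspan' x
      refine ⟨Sum.elim q r, ?_⟩
      simp only [map_sum, map_smul] at hx
      simp [Fintype.linearCombination_apply, hx]
    · refine ih ((isGraded_vecGrading _ _).subGrading _) ((isGraded_vecGrading _ _).subGrading _)
        (f := kerInl f a b) (g := kerInr g (f ∘ a) b hga) ?_ ?_ ?_ ?_ ?_ hs hs'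
      · intro x y hxy
        ext i : 2
        exact congrFun (congrArg Subtype.val hxy) (Sum.inl i)
      · intro x
        obtain ⟨w, hw⟩ := (hfg (∑ i, x.1 i • b i)).1 (by
          have := mem_ker_linearCombination.1 x.2
          simpa [Fintype.linearCombination_apply] using this)
        obtain ⟨q, rfl⟩ := haspan' w
        refine ⟨⟨Sum.elim (-q) x.1, ?_⟩, ?_⟩
        · simp only [map_sum, map_smul] at hw
          simp [Fintype.linearCombination_apply, hw]
        · ext i : 2
          rfl
      · intro x
        constructor
        · intro hx
          have hx' : ∀ i, x.1 (Sum.inr i) = 0 := fun i => congrFun (congrArg Subtype.val hx) i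
          refine ⟨⟨x.1 ∘ Sum.inl, ?_⟩, ?_⟩
          · have := x.2
            simp only [LinearMap.mem_ker, Fintype.linearCombination_apply, Fintype.sum_sum_type,
              Sum.elim_inl, Sum.elim_inr, hx', zero_smul, Finset.sum_const_zero, add_zero,
              Function.comp_apply, ← map_smul, ← map_sum] at this
            simpa [Fintype.linearCombination_apply] using hf (this.trans (map_zero f).symm)
          · ext (i | i) : 2
            · rfl
            · exact (hx' i).symm
        · rintro ⟨y, rfl⟩
          rfl
      · intro e x
        constructor
        · exact fun h i => h (Sum.inl i)
        · rintro h (i | i)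
          · exact h i
          · exact isHomogeneous_zero _ _ _
      · intro e x hx
        obtain ⟨w, hw⟩ := (hfg (∑ i, x.1 i • b i)).1 (by
          have := mem_ker_linearCombination.1 x.2
          simpa [Fintype.linearCombination_apply] using this)
        -- The correction term must be homogeneous for the lifted syzygy to be so. Its image has
        -- degree `e + 1`, because `x` has entries of that degree and the `b i` have degree zero.
        have hwdeg : w ∈ 𝒜 (e + 1) := by
          rw [← hfdeg, hw]
          exact AddSubgroup.sum_mem _ fun i _ => hB.smul_mem (i := e + 1) (hx i) (hb i)
        obtain ⟨q, hq, rfl⟩ := hA.exists_homogeneous_coeff ha haspan hwdeg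
        refine ⟨⟨Sum.elim (-q) x.1, ?_⟩, ?_, ?_⟩
        · simp only [map_sum, map_smul] at hw
          simp [Fintype.linearCombination_apply, hw]
        · rintro (i | i)
          · exact (hq i).neg
          · exact hx i
        · ext i : 2
          rfl

/-- Passage to the syzygies of the last term of a short exact sequence. -/
noncomputable def kerToKer {ι : Type} [Fintype ι] (g : B →ₗ[MvPolynomial V k] C) (b : ι → B) :
    LinearMap.ker (Fintype.linearCombination (MvPolynomial V k) (g ∘ b)) →ₗ[MvPolynomial V k]
      LinearMap.ker g :=
  ((Fintype.linearCombination (MvPolynomial V k) b).comp (Submodule.subtype _)).codRestrict _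
    fun x => by
      have := mem_ker_linearCombination.1 x.2
      simpa [Fintype.linearCombination_apply] using this

/-- Mapping cone. With the generators of `C` taken as images of those of `B`, the syzygies of `C`
are an extension of `ker g ≅ A` by the syzygies of `B`. Since `f` raises degree by one, generators
of `A` lift to linear syzygies. -/
theorem HasLinearSyzygies.quotient (hB : IsGraded k V ℬ)
    {f : A →ₗ[MvPolynomial V k] B} {g : B →ₗ[MvPolynomial V k] C} (hf : Function.Injective f)
    (hg : Function.Surjective g) (hfg : Function.Exact f g)
    (hfdeg : ∀ e, ∀ a ∈ 𝒜 e, f a ∈ ℬ (e + 1))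
    (hgdeg : ∀ b ∈ ℬ 0, g b ∈ 𝒞 0) {s : ℕ}
    (h : HasLinearSyzygies k V s 𝒜) (h' : HasLinearSyzygies k V (s + 1) ℬ) :
    HasLinearSyzygies k V (s + 1) 𝒞 := by
  obtain ⟨ι, _, b, hb, hbspan, hs⟩ := h'
  have hbspan' : LinearMap.range (Fintype.linearCombination (MvPolynomial V k) b) = ⊤ := by
    rw [Fintype.range_linearCombination, hbspan]
  refine ⟨ι, inferInstance, g ∘ b, fun i => hgdeg _ (hb i), ?_, ?_⟩
  · rw [Set.range_comp, ← Submodule.map_span, hbspan, Submodule.map_top,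
      LinearMap.range_eq_top.2 hg]
  · let ψ : A ≃ₗ[MvPolynomial V k] LinearMap.ker g :=
      (LinearEquiv.ofInjective f hf).trans
        (LinearEquiv.ofEq _ _ (LinearMap.exact_iff.1 hfg).symm)
    have hψ : ∀ x, (ψ x : B) = f x := fun x => rfl
    have hker : ∀ x, x ∈ LinearMap.ker (Fintype.linearCombination (MvPolynomial V k) b) →
        x ∈ LinearMap.ker (Fintype.linearCombination (MvPolynomial V k) (g ∘ b)) := by
      intro x hx
      have := congrArg g (LinearMap.mem_ker.1 hx)
      simpa [Fintype.linearCombination_apply] using this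
    refine HasLinearSyzygies.extension ((isGraded_vecGrading _ _).subGrading _)
      ((isGraded_vecGrading _ _).subGrading _)
      (f := Submodule.inclusion hker) (g := ψ.symm.toLinearMap ∘ₗ kerToKer g b) ?_ ?_ ?_ ?_ ?_ hs h
    · exact Submodule.inclusion_injective _
    · rw [LinearMap.coe_comp]
      refine ψ.symm.surjective.comp ?_
      rintro ⟨y, hy⟩
      obtain ⟨x, rfl⟩ := LinearMap.range_eq_top.1 hbspan' y
      refine ⟨⟨x, ?_⟩, rfl⟩
      simpa [Fintype.linearCombination_apply] using hy
    · intro x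
      simp only [LinearMap.coe_comp, LinearEquiv.coe_coe, Function.comp_apply,
        LinearEquiv.map_eq_zero_iff]
      constructor
      · intro hx
        exact ⟨⟨x.1, congrArg Subtype.val hx⟩, rfl⟩
      · rintro ⟨y, rfl⟩
        exact Subtype.ext y.2
    · exact fun e a => Iff.rfl
    · intro e c hc
      obtain ⟨r, hr, hrc⟩ := hB.exists_homogeneous_coeff hb hbspan (hfdeg e c hc)
      have hrc' : Fintype.linearCombination (MvPolynomial V k) b r = f c := by
        rw [Fintype.linearCombination_apply, hrc]
      refine ⟨⟨r, ?_⟩, hr, ?_⟩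
      · have : g (Fintype.linearCombination (MvPolynomial V k) b r) = 0 := by
          rw [hrc']; exact hfg.apply_apply_eq_zero _
        simpa [Fintype.linearCombination_apply] using this
      · simp only [LinearMap.coe_comp, LinearEquiv.coe_coe, Function.comp_apply]
        rw [LinearEquiv.symm_apply_eq]
        exact Subtype.ext hrc'

end

end LinearSyzygies

/-! ### Ideals with linear resolution; nonedge ideals -/

section Ideals

variable {k : Type u} [Field k] {V : Type v}

open MvPolynomial

/-- The ideal `J` has a linear resolution with generators of degree `t`. -/
def HasLinearResolution (t : ℕ) (J : Ideal (MvPolynomial V k)) : Prop :=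
  ∀ s, HasLinearSyzygies k V s (subGrading J (polyGrading k V t))

theorem hasLinearResolution_bot (t : ℕ) : HasLinearResolution t (⊥ : Ideal (MvPolynomial V k)) :=
  fun s => HasLinearSyzygies.of_subsingleton s

theorem hasLinearResolution_top : HasLinearResolution 0 (⊤ : Ideal (MvPolynomial V k)) := by
  intro s
  cases s with
  | zero => trivial
  | succ s =>
    refine ⟨Unit, inferInstance, fun _ => ⟨1, trivial⟩, fun _ => isHomogeneous_one _ _, ?_, ?_⟩
    · rw [eq_top_iff]
      rintro x -
      rw [Set.range_const, Submodule.mem_span_singleton]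
      exact ⟨x.1, Subtype.ext (mul_one _)⟩
    · have h : ∀ z : LinearMap.ker (Fintype.linearCombination (MvPolynomial V k)
          (fun _ : Unit => (⟨1, trivial⟩ : (⊤ : Ideal (MvPolynomial V k))))), z.1 () = 0 := by
        intro z
        simpa using congrArg Subtype.val (mem_ker_linearCombination.1 z.2)
      have : Subsingleton (LinearMap.ker (Fintype.linearCombination (MvPolynomial V k)
          (fun _ : Unit => (⟨1, trivial⟩ : (⊤ : Ideal (MvPolynomial V k)))))) :=
        ⟨fun x y => Subtype.ext (funext fun _ => (h x).trans (h y).symm)⟩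
      exact HasLinearSyzygies.of_subsingleton s

/-- Uses the exact sequence 0 → J → J ⊕ P → J + wP → 0 with maps j ↦ (wj, j) and (a, b) ↦ a - wb. A
kernel element has a = wb ∈ J, so `hw` puts b in J. With the normalised gradings the first map
raises degree by one and the second preserves it. -/
theorem HasLinearResolution.sup_span_X_mul {J P : Ideal (MvPolynomial V k)} {w : V} (hJP : J ≤ P)
    (hw : ∀ p, X w * p ∈ J → p ∈ J) {t : ℕ} (hJ : HasLinearResolution (t + 1) J)
    (hP : HasLinearResolution t P) :
    HasLinearResolution (t + 1) (J ⊔ Ideal.span {X w} * P) := by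
  intro s
  cases s with
  | zero => trivial
  | succ s =>
    have hJg : IsGraded k V (subGrading J (polyGrading k V (t + 1))) :=
      (isGraded_polyGrading _).subGrading _
    have hPg : IsGraded k V (subGrading P (polyGrading k V t)) :=
      (isGraded_polyGrading _).subGrading _
    have hB : HasLinearSyzygies k V (s + 1) (fun e =>
        (subGrading J (polyGrading k V (t + 1)) e).prod (subGrading P (polyGrading k V t) e)) := by
      refine HasLinearSyzygies.extension hJg (hJg.prod hPg)
        (f := LinearMap.inl (MvPolynomial V k) J P) (g := LinearMap.snd (MvPolynomial V k) J P)
        LinearMap.inl_injective LinearMap.snd_surjective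
        (by rw [LinearMap.exact_iff]; exact (LinearMap.range_inl _ _ _).symm) ?_ ?_
        (hJ (s + 1)) (hP (s + 1))
      · intro e a
        exact ⟨fun h => h.1, fun h => ⟨h, AddSubgroup.zero_mem _⟩⟩
      · intro e c hc
        exact ⟨(0, c), ⟨AddSubgroup.zero_mem _, hc⟩, rfl⟩
    have hmem : ∀ x : J × P, LinearMap.coprod J.subtype
        (-(X w : MvPolynomial V k) • P.subtype) x ∈ J ⊔ Ideal.span {X w} * P := by
      rintro ⟨a, b⟩
      refine Submodule.add_mem_sup a.2 ?_
      change -(X w) * b.1 ∈ _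
      rw [neg_mul]
      exact neg_mem (Ideal.mul_mem_mul (Ideal.mem_span_singleton_self _) b.2)
    obtain ⟨g, hg⟩ : ∃ g : J × P →ₗ[MvPolynomial V k]
        (J ⊔ Ideal.span {X w} * P : Ideal (MvPolynomial V k)),
        ∀ a b, (g (a, b)).1 = a.1 - X w * b.1 := by
      refine ⟨LinearMap.codRestrict _ _ hmem, fun a b => ?_⟩
      change a.1 + -(X w) * b.1 = _
      rw [neg_mul, sub_eq_add_neg]
    obtain ⟨f, hf⟩ : ∃ f : J →ₗ[MvPolynomial V k] J × P,
        ∀ j, f j = ((X w : MvPolynomial V k) • j, Submodule.inclusion hJP j) :=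
      ⟨LinearMap.prod ((X w : MvPolynomial V k) • LinearMap.id) (Submodule.inclusion hJP),
        fun _ => rfl⟩
    refine HasLinearSyzygies.quotient (hJg.prod hPg) (f := f) (g := g) ?_ ?_ ?_ ?_ ?_ (hJ s) hB
    · intro x y hxy
      rw [hf, hf] at hxy
      exact Submodule.inclusion_injective hJP (congrArg Prod.snd hxy)
    · rintro ⟨c, hc⟩
      obtain ⟨a, ha, b, hb, rfl⟩ := Submodule.mem_sup.1 hc
      obtain ⟨b, hb', rfl⟩ := Ideal.mem_span_singleton_mul.1 hb
      refine ⟨(⟨a, ha⟩, ⟨-b, neg_mem hb'⟩), Subtype.ext ?_⟩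
      rw [hg, mul_neg, sub_neg_eq_add]
    · rintro ⟨a, b⟩
      constructor
      · intro h
        have h' : a.1 = X w * b.1 := by
          rw [← sub_eq_zero, ← hg, h]; rfl
        have hb : b.1 ∈ J := hw _ (h' ▸ a.2)
        refine ⟨⟨b.1, hb⟩, ?_⟩
        rw [hf]
        exact Prod.ext (Subtype.ext h'.symm) rfl
      · rintro ⟨j, hj⟩
        rw [← hj, hf]
        apply Subtype.ext
        rw [hg]
        exact sub_self _
    · intro e a ha
      have ha' : (a.1).IsHomogeneous (e + (t + 1)) := ha
      rw [hf]
      constructor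
      · change (X w * a.1).IsHomogeneous (e + 1 + (t + 1))
        rw [show e + 1 + (t + 1) = 1 + (e + (t + 1)) by omega]
        exact (isHomogeneous_X k w).mul ha'
      · change (a.1).IsHomogeneous (e + 1 + t)
        rwa [show e + 1 + t = e + (t + 1) by omega]
    · rintro ⟨a, b⟩ ⟨ha, hb⟩
      have hb' : (b.1).IsHomogeneous (0 + t) := hb
      change ((g (a, b)).1).IsHomogeneous (0 + (t + 1))
      rw [hg]
      refine IsHomogeneous.sub ha ?_
      rw [show 0 + (t + 1) = 1 + (0 + t) by omega]
      exact (isHomogeneous_X k w).mul hb'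

/-- A generator not involving `w` that divides `X w` times a monomial already divides the monomial.
-/
theorem X_mul_mem_span_monomial {w : V} {s : Set (V →₀ ℕ)} (hs : ∀ m ∈ s, m w = 0)
    {p : MvPolynomial V k}
    (hp : X w * p ∈ Ideal.span ((fun m => monomial m (1 : k)) '' s)) :
    p ∈ Ideal.span ((fun m => monomial m (1 : k)) '' s) := by
  classical
  rw [mem_ideal_span_monomial_image] at *
  intro m hm
  obtain ⟨n, hn, hle⟩ := hp (Finsupp.single w 1 + m) (by
    rw [support_X_mul]
    exact Finset.mem_map.2 ⟨m, hm, rfl⟩)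
  refine ⟨n, hn, fun i => ?_⟩
  by_cases hi : i = w
  · rw [hi, hs n hn]; exact Nat.zero_le _
  · have := hle i
    rwa [Finsupp.add_apply, Finsupp.single_apply, if_neg (Ne.symm hi), zero_add] at this

/-- The ideal generated by a set of variables. -/
noncomputable def varIdeal (k : Type u) [Field k] {V : Type v} (W : Set V) :
    Ideal (MvPolynomial V k) := Ideal.span (X '' W)

theorem varIdeal_eq (W : Set V) : varIdeal k W =
    Ideal.span ((fun m => monomial m (1 : k)) '' ((fun w => Finsupp.single w 1) '' W)) := by
  rw [varIdeal, Set.image_image]; rfl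

/-- Variables are adjoined one at a time, with the unit ideal as `P`. -/
theorem hasLinearResolution_varIdeal (W : Finset V) :
    HasLinearResolution 1 (varIdeal k (W : Set V)) := by
  classical
  induction W using Finset.induction_on with
  | empty => simpa [varIdeal] using hasLinearResolution_bot 1
  | insert w W hw ih =>
    have : varIdeal k ((insert w W : Finset V) : Set V) =
        varIdeal k (W : Set V) ⊔ Ideal.span {X w} * ⊤ := by
      rw [Ideal.mul_top, sup_comm, varIdeal, varIdeal, Finset.coe_insert, Set.image_insert_eq,
        Ideal.span_insert]
    rw [this]
    refine HasLinearResolution.sup_span_X_mul le_top ?_ ih hasLinearResolution_top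
    intro p
    rw [varIdeal_eq]
    apply X_mul_mem_span_monomial
    rintro m ⟨x, hx, rfl⟩
    rw [Finsupp.single_apply, if_neg]
    rintro rfl
    exact hw hx

/-- The ideal generated by the products of two distinct nonadjacent vertices in `S`. -/
noncomputable def nonedgeIdeal (k : Type u) [Field k] {V : Type v} (G : SimpleGraph V)
    (S : Set V) : Ideal (MvPolynomial V k) :=
  Ideal.span {f | ∃ a ∈ S, ∃ b ∈ S, a ≠ b ∧ ¬ G.Adj a b ∧ f = X a * X b}

theorem nonedgeIdeal_eq (G : SimpleGraph V) (S : Set V) : nonedgeIdeal k G S =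
    Ideal.span ((fun m => monomial m (1 : k)) ''
      {m | ∃ a ∈ S, ∃ b ∈ S, a ≠ b ∧ ¬ G.Adj a b ∧
        m = Finsupp.single a 1 + Finsupp.single b 1}) := by
  rw [nonedgeIdeal]
  congr 1
  ext f
  constructor
  · rintro ⟨a, ha, b, hb, hab, h, rfl⟩
    exact ⟨_, ⟨a, ha, b, hb, hab, h, rfl⟩, by simp [X, monomial_mul]⟩
  · rintro ⟨_, ⟨a, ha, b, hb, hab, h, rfl⟩, rfl⟩
    exact ⟨a, ha, b, hb, hab, h, by simp [X, monomial_mul]⟩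

theorem nonedgeIdeal_insert (G : SimpleGraph V) {S : Set V} {w : V} :
    nonedgeIdeal k G (insert w S) = nonedgeIdeal k G S ⊔
      Ideal.span {X w} * varIdeal k {x | x ∈ S ∧ x ≠ w ∧ ¬ G.Adj w x} := by
  rw [varIdeal, Ideal.span_mul_span']
  rw [nonedgeIdeal, nonedgeIdeal, ← Ideal.span_union]
  apply le_antisymm
  · apply Ideal.span_le.2
    rintro _ ⟨a, ha, b, hb, hab, h, rfl⟩
    apply Ideal.subset_span
    rcases ha with rfl | ha
    · have hb' : b ∈ S := hb.resolve_left (Ne.symm hab)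
      exact Or.inr ⟨_, rfl, _, ⟨b, ⟨hb', hab.symm, h⟩, rfl⟩, rfl⟩
    · rcases hb with rfl | hb
      · exact Or.inr ⟨_, rfl, _, ⟨a, ⟨ha, hab, fun h' => h h'.symm⟩, rfl⟩, mul_comm _ _⟩
      · exact Or.inl ⟨a, ha, b, hb, hab, h, rfl⟩
  · apply Ideal.span_mono
    rintro _ (⟨a, ha, b, hb, hab, h, rfl⟩ | ⟨_, rfl, _, ⟨b, ⟨hb, hab, h⟩, rfl⟩, rfl⟩)
    · exact ⟨a, Or.inr ha, b, Or.inr hb, hab, h, rfl⟩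
    · exact ⟨w, Or.inl rfl, b, Or.inr hb, hab.symm, h, rfl⟩

/-- Induction on `S`, removing a simplicial vertex `w`. The neighbours of `w` form a clique, so
every nonedge of the rest has an endpoint not adjacent to `w`; this is the inclusion J ⊆ P. -/
theorem hasLinearResolution_nonedgeIdeal (G : SimpleGraph V)
    (hG : ∀ S : Finset V, S.Nonempty →
      ∃ w ∈ S, ∀ a ∈ S, ∀ b ∈ S, G.Adj w a → G.Adj w b → a ≠ b → G.Adj a b) (S : Finset V) :
    HasLinearResolution 2 (nonedgeIdeal k G (S : Set V)) := by
  classical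
  induction S using Finset.strongInduction with
  | H S ih =>
    rcases S.eq_empty_or_nonempty with rfl | hS
    · simpa [nonedgeIdeal] using hasLinearResolution_bot 2
    · obtain ⟨w, hwS, hw⟩ := hG S hS
      rw [← Finset.insert_erase hwS, Finset.coe_insert, nonedgeIdeal_insert]
      refine HasLinearResolution.sup_span_X_mul ?_ ?_ (ih _ (Finset.erase_ssubset hwS)) ?_
      · apply Ideal.span_le.2
        rintro _ ⟨a, ha, b, hb, hab, h, rfl⟩
        have ha' := Finset.mem_erase.1 ha
        have hb' := Finset.mem_erase.1 hb
        by_cases haw : G.Adj w a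
        · have hbw : ¬ G.Adj w b := fun hbw => h (hw a ha'.2 b hb'.2 haw hbw hab)
          exact Ideal.mul_mem_left _ _ (Ideal.subset_span ⟨b, ⟨hb, hb'.1, hbw⟩, rfl⟩)
        · exact Ideal.mul_mem_right _ _ (Ideal.subset_span ⟨a, ⟨ha, ha'.1, haw⟩, rfl⟩)
      · intro p
        rw [nonedgeIdeal_eq]
        apply X_mul_mem_span_monomial
        rintro m ⟨a, ha, b, hb, hab, h, rfl⟩
        rw [Finsupp.add_apply, Finsupp.single_apply, Finsupp.single_apply,
          if_neg (Finset.ne_of_mem_erase ha), if_neg (Finset.ne_of_mem_erase hb), add_zero]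
      · convert hasLinearResolution_varIdeal (k := k)
          ((S.erase w).filter (fun x => x ≠ w ∧ ¬ G.Adj w x)) using 2
        ext x
        simp [and_assoc, and_comm]

theorem isFace_cliqueComplex (G : SimpleGraph V) (s : Finset V) :
    IsFace (cliqueComplex G) s ↔ G.IsClique (s : Set V) := by
  constructor
  · rintro (rfl | h)
    · simp
    · exact h.2
  · intro h
    rcases s.eq_empty_or_nonempty with h' | h'
    · exact Or.inl h'
    · exact Or.inr ⟨h', h⟩

/-- A non-clique contains a nonadjacent pair, so its monomial is divisible by a quadratic generator.
-/
theorem stanleyReisnerIdeal_cliqueComplex (G : SimpleGraph V) :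
    stanleyReisnerIdeal k (cliqueComplex G) = nonedgeIdeal k G Set.univ := by
  classical
  apply le_antisymm
  · apply Ideal.span_le.2
    rintro _ ⟨s, hs, rfl⟩
    rw [isFace_cliqueComplex, SimpleGraph.IsClique, Set.Pairwise] at hs
    push Not at hs
    obtain ⟨a, ha, b, hb, hab, h⟩ := hs
    have hsub : ({a, b} : Finset V) ⊆ s := by
      intro x hx
      simp only [Finset.mem_insert, Finset.mem_singleton] at hx
      rcases hx with rfl | rfl
      · exact ha
      · exact hb
    refine Ideal.mem_of_dvd _ (Finset.prod_dvd_prod_of_subset _ _ _ hsub)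
      (Ideal.subset_span ⟨a, trivial, b, trivial, hab, h, ?_⟩)
    rw [Finset.prod_pair hab]
  · apply Ideal.span_le.2
    rintro _ ⟨a, -, b, -, hab, h, rfl⟩
    refine Ideal.subset_span ⟨{a, b}, ?_, (Finset.prod_pair hab).symm⟩
    rw [isFace_cliqueComplex]
    intro hcl
    exact h (hcl (by simp) (by simp) hab)

end Ideals

/-! ### Dirac's theorem on simplicial vertices -/

section SimplicialVertex

variable {V : Type v}

/-- Shortest walks are chordless: an edge between two vertices that are not consecutive would be a
shortcut. -/
theorem mem_edges_of_length_eq_dist {G : SimpleGraph V} {u w : V} {p : G.Walk u w}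
    (hp : p.length = G.dist u w) {x y : V} (hx : x ∈ p.support) (hy : y ∈ p.support)
    (h : G.Adj x y) : s(x, y) ∈ p.edges := by
  obtain ⟨i, rfl, hi⟩ := SimpleGraph.Walk.mem_support_iff_exists_getVert.1 hx
  obtain ⟨j, rfl, hj⟩ := SimpleGraph.Walk.mem_support_iff_exists_getVert.1 hy
  have key : ∀ i j, i ≤ p.length → j ≤ p.length → i < j → G.Adj (p.getVert i) (p.getVert j) →
      s(p.getVert i, p.getVert j) ∈ p.edges := by
    intro i j hi hj hij h
    have hle := SimpleGraph.dist_le ((p.take i).append (SimpleGraph.Walk.cons h (p.drop j)))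
    rw [SimpleGraph.Walk.length_append, SimpleGraph.Walk.length_cons,
      SimpleGraph.Walk.take_length, SimpleGraph.Walk.drop_length, ← hp] at hle
    obtain rfl : j = i + 1 := by omega
    have hlen : i < p.edges.length := by rw [SimpleGraph.Walk.length_edges]; omega
    rw [← SimpleGraph.Walk.getElem_edges hlen]
    exact List.getElem_mem _
  rcases lt_trichotomy i j with hij | rfl | hij
  · exact key i j hi hj hij h
  · exact (G.irrefl h).elim
  · rw [Sym2.eq_swap]
    exact key j i hj hi hij h.symm

/-- In a chordal graph, two vertices that are joined by a path inside `X` and have a common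
neighbour not adjacent to `X` are adjacent. -/
theorem IsChordal.adj_of_common_neighbor {G : SimpleGraph V} (hG : IsChordal G) {X : Set V}
    (hX : (G.induce X).Preconnected) {z₁ z₂ x₁ x₂ y : V} (hx₁ : x₁ ∈ X) (hx₂ : x₂ ∈ X)
    (h₁ : G.Adj x₁ z₁) (h₂ : G.Adj x₂ z₂) (hz : z₁ ≠ z₂) (hy₁ : G.Adj z₁ y) (hy₂ : G.Adj z₂ y)
    (hyX : y ∉ X) (hy : ∀ x ∈ X, ¬ G.Adj x y) : G.Adj z₁ z₂ := by
  by_contra hadj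
  set Z : Set V := (X ∪ {x₁, z₁}) ∪ {x₂, z₂} with hZ
  have hconn : (G.induce Z).Connected :=
    SimpleGraph.induce_union_connected
      (SimpleGraph.induce_union_connected hX
        (SimpleGraph.induce_pair_connected_of_adj h₁).preconnected
        ⟨x₁, hx₁, Or.inl rfl⟩).preconnected
      (SimpleGraph.induce_pair_connected_of_adj h₂).preconnected
      ⟨x₂, Or.inl hx₂, Or.inl rfl⟩
  have hZmem : ∀ a ∈ Z, a ∈ X ∨ a = z₁ ∨ a = z₂ := by
    rintro a ((ha | rfl | rfl) | rfl | rfl)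
    · exact Or.inl ha
    · exact Or.inl hx₁
    · exact Or.inr (Or.inl rfl)
    · exact Or.inl hx₂
    · exact Or.inr (Or.inr rfl)
  have hz₁ : z₁ ∈ Z := Or.inl (Or.inr (Or.inr rfl))
  have hz₂ : z₂ ∈ Z := Or.inr (Or.inr rfl)
  have hyZ : y ∉ Z := fun h => by
    rcases hZmem y h with h | rfl | rfl
    · exact hyX h
    · exact G.irrefl hy₁
    · exact G.irrefl hy₂
  -- If z₁ and z₂ were not adjacent, a shortest path between them inside Z would have length at
  -- least two. Closing it up through `y` gives a cycle of length at least four. It has no chord,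
  -- since the path is induced in Z and `y` sees only z₁ and z₂ there.
  obtain ⟨p, hp⟩ := hconn.exists_walk_length_eq_dist ⟨z₁, hz₁⟩ ⟨z₂, hz₂⟩
  have hpath := p.isPath_of_length_eq_dist hp
  let q : G.Walk z₁ z₂ := p.map (SimpleGraph.Embedding.induce Z).toHom
  have hq : q.IsPath :=
    hpath.map Subtype.val_injective
  have hqsupp : q.support = p.support.map Subtype.val := SimpleGraph.Walk.support_map _ _
  have hqedges : q.edges = p.edges.map (Sym2.map Subtype.val) := SimpleGraph.Walk.edges_map _ _
  have hqs : ∀ a ∈ q.support, a ∈ Z := by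
    intro a ha
    rw [hqsupp, List.mem_map] at ha
    obtain ⟨b, -, rfl⟩ := ha
    exact b.2
  have hqe : ∀ a ∈ q.support, ∀ b ∈ q.support, G.Adj a b → s(a, b) ∈ q.edges := by
    intro a ha b hb hab
    rw [hqsupp, List.mem_map] at ha hb
    obtain ⟨a, ha, rfl⟩ := ha
    obtain ⟨b, hb, rfl⟩ := hb
    rw [hqedges, List.mem_map]
    exact ⟨s(a, b), mem_edges_of_length_eq_dist hp ha hb hab, rfl⟩
  have hlen : 2 ≤ q.length := by
    by_contra hlt
    have h01 : q.length = 0 ∨ q.length = 1 := by omega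
    rcases h01 with h0 | h1
    · exact hz (SimpleGraph.Walk.eq_of_length_eq_zero h0)
    · exact hadj (SimpleGraph.Walk.adj_of_length_eq_one h1)
  have hyq : y ∉ q.support := fun h => hyZ (hqs y h)
  let c : G.Walk y y := SimpleGraph.Walk.cons hy₁.symm (q.concat hy₂)
  have hc : c.IsCycle := by
    rw [SimpleGraph.Walk.cons_isCycle_iff]
    refine ⟨hq.concat hyq hy₂, ?_⟩
    rw [SimpleGraph.Walk.edges_concat, List.concat_eq_append, List.mem_append, List.mem_singleton]
    rintro (h | h)
    · exact hyq (SimpleGraph.Walk.fst_mem_support_of_mem_edges _ h)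
    · rw [Sym2.eq_iff] at h
      rcases h with ⟨h, -⟩ | ⟨-, h⟩
      · exact hyZ (h ▸ hz₂)
      · exact hz h
  have hedges : c.edges = s(y, z₁) :: (q.edges ++ [s(z₂, y)]) := by
    rw [SimpleGraph.Walk.edges_cons, SimpleGraph.Walk.edges_concat, List.concat_eq_append]
  have hsupp : ∀ a ∈ c.support, a = y ∨ a ∈ q.support := by
    intro a ha
    rw [SimpleGraph.Walk.support_cons, SimpleGraph.Walk.support_concat] at ha
    simp only [List.mem_cons, List.mem_append, List.not_mem_nil,
      or_false] at ha
    tauto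
  have hyadj : ∀ a ∈ q.support, G.Adj y a → s(y, a) ∈ c.edges := by
    intro a ha hya
    rw [hedges]
    rcases hZmem a (hqs a ha) with h | rfl | rfl
    · exact (hy a h hya.symm).elim
    · simp
    · simp [Sym2.eq_swap]
  obtain ⟨a, ha, b, hb, hab, hnot⟩ := hG y c hc (by
    rw [SimpleGraph.Walk.length_cons, SimpleGraph.Walk.length_concat]; omega)
  rcases hsupp a ha with rfl | ha
  · rcases hsupp b hb with rfl | hb
    · exact G.irrefl hab
    · exact hnot (hyadj b hb hab)
  · rcases hsupp b hb with rfl | hb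
    · rw [Sym2.eq_swap] at hnot
      exact hnot (hyadj _ ‹a ∈ q.support› hab.symm)
    · refine hnot ?_
      rw [hedges]
      exact List.mem_cons_of_mem _ (List.mem_append_left _ (hqe a ha b hb hab))

/-- Dirac's theorem: every induced subgraph of a chordal graph has a simplicial vertex. -/
theorem IsChordal.exists_simplicial {G : SimpleGraph V} (hG : IsChordal G) (S : Finset V)
    (hS : S.Nonempty) :
    ∃ w ∈ S, ∀ a ∈ S, ∀ b ∈ S, G.Adj w a → G.Adj w b → a ≠ b → G.Adj a b := by
  classical
  induction S using Finset.strongInduction with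
  | H S ih =>
    by_cases huniv : ∀ u ∈ S, ∀ y ∈ S, y ≠ u → G.Adj u y
    · obtain ⟨w, hw⟩ := hS
      exact ⟨w, hw, fun a ha b hb _ _ hab => huniv a ha b hb hab.symm⟩
    push Not at huniv
    obtain ⟨u, hu, y₀, hy₀, hyu, hady⟩ := huniv
    -- Take a largest connected X ⊆ S that misses and is not adjacent to some vertex of S. The
    -- vertices of this last kind form Y, to which the induction hypothesis applies.
    let 𝒳 : Finset (Finset V) := S.powerset.filter fun X => X.Nonempty ∧
      (G.induce (X : Set V)).Preconnected ∧ ∃ y ∈ S, y ∉ X ∧ ∀ x ∈ X, ¬ G.Adj x y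
    have h𝒳 : 𝒳.Nonempty := by
      refine ⟨{u}, Finset.mem_filter.2 ⟨by simpa using hu, by simp, ?_, y₀, hy₀, by simpa using hyu,
        by simpa using hady⟩⟩
      have : Subsingleton (({u} : Finset V) : Set V) := by
        rw [Finset.coe_singleton]; infer_instance
      exact SimpleGraph.Preconnected.of_subsingleton
    obtain ⟨X, hX, hmax⟩ := Finset.exists_max_image 𝒳 Finset.card h𝒳
    obtain ⟨hXS, ⟨x₀, hx₀⟩, hXc, y₁, hy₁, hy₁X, hy₁adj⟩ := Finset.mem_filter.1 hX
    have hXS := Finset.mem_powerset.1 hXS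
    let Y : Finset V := S.filter fun y => y ∉ X ∧ ∀ x ∈ X, ¬ G.Adj x y
    have hYS : Y ⊂ S := by
      refine ⟨Finset.filter_subset _ _, fun h => ?_⟩
      exact (Finset.mem_filter.1 (h (hXS hx₀))).2.1 hx₀
    obtain ⟨w, hwY, hw⟩ := ih Y hYS ⟨y₁, Finset.mem_filter.2 ⟨hy₁, hy₁X, hy₁adj⟩⟩
    -- By maximality every boundary vertex of X is adjacent to all of Y; otherwise X ∪ {z} would
    -- still be admissible, witnessed by `y`.
    have hcomplete : ∀ z ∈ S, z ∉ X → ∀ x ∈ X, G.Adj x z → ∀ y ∈ Y, G.Adj z y := by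
      intro z hz hzX x hx hxz y hy
      by_contra hzy
      obtain ⟨hyS, hyX, hyadj⟩ := Finset.mem_filter.1 hy
      have hmem : insert z X ∈ 𝒳 := by
        refine Finset.mem_filter.2 ⟨Finset.mem_powerset.2 (Finset.insert_subset hz hXS),
          Finset.insert_nonempty _ _, ?_, y, hyS, ?_, ?_⟩
        · have := (SimpleGraph.induce_union_connected hXc
            (SimpleGraph.induce_pair_connected_of_adj hxz).preconnected
            ⟨x, hx, Or.inl rfl⟩).preconnected
          have heq : ((insert z X : Finset V) : Set V) = (X : Set V) ∪ {x, z} := by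
            ext a
            simp only [Finset.coe_insert, Set.mem_insert_iff, Finset.mem_coe, Set.mem_union,
              Set.mem_singleton_iff]
            constructor
            · tauto
            · rintro (h | rfl | h)
              · exact Or.inr h
              · exact Or.inr hx
              · exact Or.inl h
          rwa [heq]
        · rw [Finset.mem_insert]
          rintro (rfl | h)
          · exact hyadj x hx hxz
          · exact hyX h
        · intro a ha
          rcases Finset.mem_insert.1 ha with rfl | ha
          · exact hzy
          · exact hyadj a ha
      have := hmax _ hmem
      rw [Finset.card_insert_of_notMem hzX] at this
      omega
    obtain ⟨hwS, hwX, hwadj⟩ := Finset.mem_filter.1 hwY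
    have hnbr : ∀ a ∈ S, G.Adj w a → a ∈ Y ∨ (a ∉ X ∧ ∃ x ∈ X, G.Adj x a) := by
      intro a ha hwa
      have haX : a ∉ X := fun h => hwadj a h hwa.symm
      by_cases h : ∃ x ∈ X, G.Adj x a
      · exact Or.inr ⟨haX, h⟩
      · push Not at h
        exact Or.inl (Finset.mem_filter.2 ⟨ha, haX, h⟩)
    refine ⟨w, hwS, fun a ha b hb hwa hwb hab => ?_⟩
    -- Two neighbours in Y are adjacent because `w` is simplicial in Y, mixed pairs by `hcomplete`,
    -- and two boundary vertices by chordality.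
    rcases hnbr a ha hwa with haY | ⟨haX, x, hx, hxa⟩
    · rcases hnbr b hb hwb with hbY | ⟨hbX, x', hx', hxb⟩
      · exact hw a haY b hbY hwa hwb hab
      · exact (hcomplete b hb hbX x' hx' hxb a haY).symm
    · rcases hnbr b hb hwb with hbY | ⟨hbX, x', hx', hxb⟩
      · exact hcomplete a ha haX x hx hxa b hbY
      · exact hG.adj_of_common_neighbor hXc hx hx' hxa hxb hab hwa.symm hwb.symm hwX hwadj

end SimplicialVertex

/-! ### Independence of generators and existence of the resolution -/

section Resolutions

variable {k : Type u} [Field k] {V : Type v}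

open MvPolynomial

theorem constantCoeff_eq_zero_of_isHomogeneous {p : MvPolynomial V k} {n : ℕ}
    (hp : p.IsHomogeneous n) (hn : n ≠ 0) : constantCoeff p = 0 := by
  rw [constantCoeff_eq]
  exact hp.coeff_eq_zero (by rw [map_zero]; exact hn.symm)

theorem eq_zero_of_isHomogeneous_zero {p : MvPolynomial V k} (hp : p.IsHomogeneous 0)
    (h : constantCoeff p = 0) : p = 0 := by
  ext m
  by_cases hm : m = 0
  · rw [hm, coeff_zero, ← constantCoeff_eq, h]
  · rw [hp.coeff_eq_zero (by rwa [Ne, Finsupp.degree_eq_zero_iff]), coeff_zero]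

theorem map_eq_sum_smul {M : Type*} [AddCommGroup M] [Module (MvPolynomial V k) M] {κ : Type*}
    [Fintype κ] [DecidableEq κ] (p : (κ → MvPolynomial V k) →ₗ[MvPolynomial V k] M)
    (x : κ → MvPolynomial V k) : p x = ∑ j, x j • p (Pi.single j 1) := by
  conv_lhs => rw [pi_eq_sum_univ' x]
  simp only [map_sum, map_smul]

theorem HasLinearSyzygies.constantCoeff_eq_zero {κ : Type} {K : Submodule (MvPolynomial V k)
    (κ → MvPolynomial V k)} {t : ℕ} {s : ℕ}
    (h : HasLinearSyzygies k V (s + 1) (subGrading K (vecGrading k V κ (t + 1)))) :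
    ∀ x ∈ K, ∀ j, constantCoeff (x j) = 0 := by
  obtain ⟨ι, _, g, hg, hspan, -⟩ := h
  intro x hx j
  obtain ⟨r, hr⟩ := exists_sum_smul_eq hspan ⟨x, hx⟩
  have hx' : x = ∑ i, r i • (g i).1 := by simpa using congrArg Subtype.val hr.symm
  rw [hx', Finset.sum_apply, map_sum]
  refine Finset.sum_eq_zero fun i _ => ?_
  rw [Pi.smul_apply, smul_eq_mul, map_mul,
    constantCoeff_eq_zero_of_isHomogeneous (p := (g i).1 j) (hg i j) (by omega), mul_zero]

/-- Linearity of the syzygies does not depend on the choice of minimal generators. -/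
theorem HasLinearSyzygies.ker_of_minimal {M : Type (max u v)} [AddCommGroup M]
    [Module (MvPolynomial V k) M] {𝓜 : ℕ → AddSubgroup M} (hM : IsGraded k V 𝓜)
    (h : ∀ s, HasLinearSyzygies k V s 𝓜) {κ : Type} [Fintype κ] [DecidableEq κ]
    (p : (κ → MvPolynomial V k) →ₗ[MvPolynomial V k] M) (hp : Function.Surjective p)
    (hdeg : ∀ j, p (Pi.single j 1) ∈ 𝓜 0)
    (hmin : ∀ x ∈ LinearMap.ker p, ∀ j, constantCoeff (x j) = 0) (s : ℕ) :
    HasLinearSyzygies k V s (subGrading (LinearMap.ker p) (vecGrading k V κ 1)) := by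
  classical
  -- Beyond the layer for `g` itself, one extra layer is requested so that the syzygies of `g` are
  -- known to have no constant terms.
  obtain ⟨ι, _, g, hg, hspan, hs⟩ := h (s + 2)
  have hming := hs.constantCoeff_eq_zero
  have hspan' : Submodule.span (MvPolynomial V k) (Set.range fun j => p (Pi.single j 1)) = ⊤ := by
    rw [eq_top_iff]
    rintro m -
    obtain ⟨x, rfl⟩ := hp m
    rw [map_eq_sum_smul]
    exact Submodule.sum_mem _ fun j _ => Submodule.smul_mem _ _ (Submodule.subset_span ⟨j, rfl⟩)
  choose c hc hce using fun j => hM.exists_homogeneous_coeff hg hspan (hdeg j)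
  choose y hy hye using fun i => hM.exists_homogeneous_coeff hdeg hspan' (hg i)
  let φ := Matrix.vecMulLinear (Matrix.of c : Matrix κ ι (MvPolynomial V k))
  let ψ := Matrix.vecMulLinear (Matrix.of y : Matrix ι κ (MvPolynomial V k))
  have hφ : ∀ x i, φ x i = ∑ j, x j * c j i := fun x i => rfl
  have hψ : ∀ x j, ψ x j = ∑ i, x i * y i j := fun x i => rfl
  have hgφ : ∀ x, ∑ i, φ x i • g i = p x := by
    intro x
    rw [map_eq_sum_smul p x]
    simp_rw [hφ, Finset.sum_smul, ← hce, Finset.smul_sum, mul_smul]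
    exact Finset.sum_comm
  have hpψ : ∀ x, p (ψ x) = ∑ i, x i • g i := by
    intro x
    rw [map_eq_sum_smul p]
    simp_rw [hψ, Finset.sum_smul, ← hye, Finset.smul_sum, mul_smul]
    exact Finset.sum_comm
  have hδ : ∀ {α : Type} [DecidableEq α] (a b : α),
      ((Pi.single a 1 : α → MvPolynomial V k) b).IsHomogeneous 0 := by
    intro α _ a b
    rw [Pi.single_apply]
    split_ifs
    · exact isHomogeneous_one _ _
    · exact isHomogeneous_zero _ _ _
  -- The columns of ψφ - 1 are syzygies, so their constant terms vanish; their entries also have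
  -- degree zero, so they are zero. The same argument applies to φψ.
  have hψφ : ψ ∘ₗ φ = LinearMap.id := by
    refine LinearMap.pi_ext' fun j => LinearMap.ext_ring ?_
    change ψ (φ (Pi.single j 1)) = Pi.single j 1
    rw [← sub_eq_zero]
    funext l
    refine eq_zero_of_isHomogeneous_zero ?_ (hmin _ ?_ l)
    · refine IsHomogeneous.sub ?_ (hδ j l)
      rw [hψ]
      refine IsHomogeneous.sum _ _ _ fun i _ => ?_
      rw [hφ]
      refine IsHomogeneous.mul (m := 0) (n := 0) (IsHomogeneous.sum _ _ _ fun j' _ => ?_) (hy i l)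
      exact IsHomogeneous.mul (m := 0) (n := 0) (hδ j j') (hc j' i)
    · rw [LinearMap.mem_ker, map_sub, hpψ, hgφ, sub_self]
  have hφψ : φ ∘ₗ ψ = LinearMap.id := by
    refine LinearMap.pi_ext' fun j => LinearMap.ext_ring ?_
    change φ (ψ (Pi.single j 1)) = Pi.single j 1
    rw [← sub_eq_zero]
    funext l
    refine eq_zero_of_isHomogeneous_zero ?_ (hming _ ?_ l)
    · refine IsHomogeneous.sub ?_ (hδ j l)
      rw [hφ]
      refine IsHomogeneous.sum _ _ _ fun i _ => ?_
      rw [hψ]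
      refine IsHomogeneous.mul (m := 0) (n := 0) (IsHomogeneous.sum _ _ _ fun j' _ => ?_) (hc i l)
      exact IsHomogeneous.mul (m := 0) (n := 0) (hδ j j') (hy j' i)
    · rw [mem_ker_linearCombination]
      simp only [Pi.sub_apply, sub_smul, Finset.sum_sub_distrib]
      rw [hgφ, hpψ, sub_self]
  let E : (ι → MvPolynomial V k) ≃ₗ[MvPolynomial V k] (κ → MvPolynomial V k) :=
    LinearEquiv.ofLinearMap ψ φ hψφ hφψ
  have hE : (LinearMap.ker (Fintype.linearCombination (MvPolynomial V k) g)).map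
      (E : (ι → MvPolynomial V k) →ₗ[MvPolynomial V k] _) = LinearMap.ker p := by
    ext x
    rw [Submodule.mem_map]
    constructor
    · rintro ⟨z, hz, rfl⟩
      rw [mem_ker_linearCombination] at hz
      exact (hpψ z).trans hz
    · intro hx
      refine ⟨φ x, ?_, DFunLike.congr_fun hψφ x⟩
      rw [mem_ker_linearCombination, hgφ]
      exact hx
  refine HasLinearSyzygies.of_linearEquiv (E.ofSubmodules _ _ hE) ?_ hs.of_succ
  intro a ha j
  change (ψ a.1 j).IsHomogeneous (0 + 1)
  rw [hψ]
  exact IsHomogeneous.sum _ _ _ fun i _ => IsHomogeneous.mul (m := 0 + 1) (n := 0) (ha i) (hy i j)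

theorem weight_one_apply (m : V →₀ ℕ) : Finsupp.weight (1 : V → ℕ) m = m.degree := by
  rw [Finsupp.degree_eq_weight_one]
  rfl

theorem isHomogeneousVec_const {b c e n : ℕ} (h : c + n = e) (x : Fin b → MvPolynomial V k) :
    IsHomogeneousVec (fun _ => c) e x ↔ ∀ l, (x l).IsHomogeneous n := by
  constructor
  · intro hx l m hm
    have : c + m.degree = e := hx l m (mem_support_iff.2 hm)
    rw [weight_one_apply]
    omega
  · intro hx l m hm
    have := hx l (mem_support_iff.1 hm)
    rw [weight_one_apply] at this
    change c + m.degree = e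
    omega

theorem exists_of_mem_support_sum_mul {ι : Type*} {S : Finset ι} {f g : ι → MvPolynomial V k}
    {m : V →₀ ℕ} (hm : m ∈ (∑ i ∈ S, f i * g i).support) :
    ∃ i ∈ S, ∃ m₁ ∈ (f i).support, ∃ m₂ ∈ (g i).support, m₁ + m₂ = m := by
  classical
  obtain ⟨i, hi, hm⟩ := Finset.mem_biUnion.1 (support_sum hm)
  exact ⟨i, hi, Finset.mem_add.1 (support_mul _ _ hm)⟩

theorem isHomogeneousVec_map {b b' : ℕ} {a : Fin b → ℕ} {a' : Fin b' → ℕ}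
    (d : (Fin b → MvPolynomial V k) →ₗ[MvPolynomial V k] (Fin b' → MvPolynomial V k))
    (hd : ∀ j, IsHomogeneousVec a' (a j) (d (Pi.single j 1))) {e : ℕ}
    {x : Fin b → MvPolynomial V k} (hx : IsHomogeneousVec a e x) :
    IsHomogeneousVec a' e (d x) := by
  intro l m hm
  rw [map_eq_sum_smul, Finset.sum_apply] at hm
  obtain ⟨j, -, m₁, hm₁, m₂, hm₂, rfl⟩ := exists_of_mem_support_sum_mul hm
  have h₁ := hx j m₁ hm₁
  have h₂ := hd j l m₂ hm₂
  rw [map_add]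
  omega

/-- A finitely generated graded submodule of a free module all of whose syzygies are linear. -/
structure LinearStage (k : Type u) [Field k] (V : Type v) where
  /-- the rank of the free module -/
  rank : ℕ
  /-- the degree of the coordinates of the generators -/
  deg : ℕ
  deg_ne_zero : deg ≠ 0
  /-- the submodule -/
  carrier : Submodule (MvPolynomial V k) (Fin rank → MvPolynomial V k)
  linear : ∀ s, HasLinearSyzygies k V s (subGrading carrier (vecGrading k V (Fin rank) deg))

/-- The generators in `HasLinearSyzygies` may vary with `s`, whereas a resolution needs a single
choice good for all `s`. Minimal generators are taken from `s = 2`, and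
`HasLinearSyzygies.ker_of_minimal` transfers every `s` to them. -/
theorem LinearStage.exists_cover (S : LinearStage k V) :
    ∃ (b : ℕ) (d : (Fin b → MvPolynomial V k) →ₗ[MvPolynomial V k]
        (Fin S.rank → MvPolynomial V k)),
      LinearMap.range d = S.carrier ∧ (∀ j l, (d (Pi.single j 1) l).IsHomogeneous S.deg) ∧
      ∀ s, HasLinearSyzygies k V s (subGrading (LinearMap.ker d) (vecGrading k V (Fin b) 1)) := by
  classical
  obtain ⟨ι, _, g, hg, hspan, hs⟩ := S.linear 2
  have hmin := hs.constantCoeff_eq_zero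
  let ε := Fintype.equivFin ι
  let p : (Fin (Fintype.card ι) → MvPolynomial V k) →ₗ[MvPolynomial V k] S.carrier :=
    Fintype.linearCombination (MvPolynomial V k) (g ∘ ε.symm)
  have hp1 : ∀ j, p (Pi.single j 1) = g (ε.symm j) := by
    intro j
    simp [p, Fintype.linearCombination_apply_single]
  have hpsurj : Function.Surjective p := by
    rw [← LinearMap.range_eq_top, Fintype.range_linearCombination, Set.range_comp,
      ε.symm.range_eq_univ, Set.image_univ, hspan]
  have hpmin : ∀ x ∈ LinearMap.ker p, ∀ j, constantCoeff (x j) = 0 := by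
    intro x hx j
    have := hmin (x ∘ ε) (by
      rw [mem_ker_linearCombination] at hx ⊢
      rw [← hx, ← ε.sum_comp]
      simp) (ε.symm j)
    simpa using this
  refine ⟨Fintype.card ι, S.carrier.subtype ∘ₗ p, ?_, ?_, ?_⟩
  · rw [LinearMap.range_comp, LinearMap.range_eq_top.2 hpsurj, Submodule.map_top,
      Submodule.range_subtype]
  · intro j l
    rw [LinearMap.comp_apply, hp1]
    have := hg (ε.symm j) l
    rwa [zero_add] at this
  · rw [LinearMap.ker_comp_of_ker_eq_bot _ S.carrier.ker_subtype]
    exact HasLinearSyzygies.ker_of_minimal ((isGraded_vecGrading _ _).subGrading _) S.linear p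
      hpsurj (fun j => by rw [hp1]; exact hg _) hpmin

/-- The stage given by the syzygies of minimal generators. -/
noncomputable def LinearStage.next (S : LinearStage k V) : LinearStage k V where
  rank := S.exists_cover.choose
  deg := 1
  deg_ne_zero := one_ne_zero
  carrier := LinearMap.ker S.exists_cover.choose_spec.choose
  linear := S.exists_cover.choose_spec.choose_spec.2.2

/-- The map onto a stage from the free module of the next one. -/
noncomputable def LinearStage.cover (S : LinearStage k V) :
    (Fin S.next.rank → MvPolynomial V k) →ₗ[MvPolynomial V k] (Fin S.rank → MvPolynomial V k) :=
  S.exists_cover.choose_spec.choose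

theorem LinearStage.range_cover (S : LinearStage k V) : LinearMap.range S.cover = S.carrier :=
  S.exists_cover.choose_spec.choose_spec.1

theorem LinearStage.cover_single (S : LinearStage k V) (j : Fin S.next.rank) (l : Fin S.rank) :
    (S.cover (Pi.single j 1) l).IsHomogeneous S.deg :=
  S.exists_cover.choose_spec.choose_spec.2.1 j l

theorem LinearStage.exact_cover (S : LinearStage k V) : Function.Exact S.next.cover S.cover := by
  rw [LinearMap.exact_iff, S.next.range_cover]
  rfl

theorem LinearStage.constantCoeff_cover (S : LinearStage k V) (x : Fin S.next.rank → MvPolynomial V k)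
    (l : Fin S.rank) : constantCoeff (S.cover x l) = 0 := by
  rw [map_eq_sum_smul, Finset.sum_apply, map_sum]
  refine Finset.sum_eq_zero fun j _ => ?_
  rw [Pi.smul_apply, smul_eq_mul, map_mul,
    constantCoeff_eq_zero_of_isHomogeneous (S.cover_single j l) S.deg_ne_zero, mul_zero]

/-- The first stage: an ideal with linear resolution. -/
noncomputable def LinearStage.ofIdeal {I : Ideal (MvPolynomial V k)} {t : ℕ} (ht : t ≠ 0)
    (hI : HasLinearResolution t I) : LinearStage k V where
  rank := 1
  deg := t
  deg_ne_zero := ht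
  carrier := Submodule.map
    ((LinearEquiv.funUnique (Fin 1) (MvPolynomial V k) (MvPolynomial V k)).symm :
      MvPolynomial V k →ₗ[MvPolynomial V k] _) I
  linear := fun s => HasLinearSyzygies.of_linearEquiv
    (𝒜 := subGrading I (polyGrading k V t))
    ((LinearEquiv.funUnique (Fin 1) (MvPolynomial V k) (MvPolynomial V k)).symm.ofSubmodules
      I _ rfl) (by intro a ha j; exact ha) (hI s)

/-- The augmentation from a free module of rank one. -/
noncomputable def idealAug (I : Ideal (MvPolynomial V k)) :
    (Fin 1 → MvPolynomial V k) →ₗ[MvPolynomial V k] (MvPolynomial V k ⧸ I) :=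
  (Submodule.mkQ I).comp (LinearMap.proj 0)

theorem mem_map_funUnique_symm {I : Ideal (MvPolynomial V k)} (x : Fin 1 → MvPolynomial V k) :
    x ∈ Submodule.map
      ((LinearEquiv.funUnique (Fin 1) (MvPolynomial V k) (MvPolynomial V k)).symm :
        MvPolynomial V k →ₗ[MvPolynomial V k] _) I ↔ x 0 ∈ I := by
  rw [Submodule.mem_map]
  constructor
  · rintro ⟨y, hy, rfl⟩
    exact hy
  · intro hx
    exact ⟨x 0, hx, funext fun j => congrArg x (Subsingleton.elim 0 j)⟩

theorem LinearStage.exact_cover_ofIdeal {I : Ideal (MvPolynomial V k)} {t : ℕ} (ht : t ≠ 0)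
    (hI : HasLinearResolution t I) :
    Function.Exact (LinearStage.ofIdeal ht hI).cover (idealAug I) := by
  intro x
  have h : x ∈ Set.range (LinearStage.ofIdeal ht hI).cover ↔
      x ∈ (LinearStage.ofIdeal ht hI).carrier := by
    rw [← LinearStage.range_cover]; rfl
  rw [h]
  exact (Submodule.Quotient.mk_eq_zero I).trans (mem_map_funUnique_symm x).symm

/-- The stages of a linear resolution. -/
noncomputable def LinearStage.iterate (S : LinearStage k V) : ℕ → LinearStage k V
  | 0 => S
  | n + 1 => (S.iterate n).next

/-- An ideal with linear resolution has a minimal graded free resolution. -/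
noncomputable def linearResolution {I : Ideal (MvPolynomial V k)} {t : ℕ} (ht : t ≠ 0)
    (hI : HasLinearResolution t I) : MinimalGradedFreeResolution I where
  rank i := ((LinearStage.ofIdeal ht hI).iterate i).rank
  shift i _ := match i with
    | 0 => 0
    | i + 1 => t + i
  d i := ((LinearStage.ofIdeal ht hI).iterate i).cover
  aug := idealAug I
  d_homogeneous i e x hx := by
    refine isHomogeneousVec_map _ (fun j => ?_) hx
    cases i with
    | zero =>
      refine (isHomogeneousVec_const (n := t) (by simp) _).2 fun l => ?_
      exact LinearStage.cover_single _ j l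
    | succ i =>
      refine (isHomogeneousVec_const (n := 1) (by simp; omega) _).2 fun l => ?_
      exact LinearStage.cover_single _ j l
  aug_homogeneous e x hx := 
    ⟨x (0 : Fin 1), (isHomogeneousVec_const (n := e) (zero_add e) x).1 hx (0 : Fin 1), rfl⟩
  aug_surjective := (Submodule.mkQ_surjective I).comp fun x => ⟨fun _ => x, rfl⟩
  exact_aug := LinearStage.exact_cover_ofIdeal ht hI
  exact_d i := LinearStage.exact_cover _
  minimal i x l := LinearStage.constantCoeff_cover _ x l

end Resolutions

/-! ### Linearity of every minimal resolution -/

section Uniqueness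

variable {k : Type u} [Field k] {V : Type v}

open MvPolynomial

theorem constantCoeff_single_ne_zero {b : ℕ} (j : Fin b) :
    constantCoeff ((Pi.single j 1 : Fin b → MvPolynomial V k) j) ≠ 0 := by
  rw [Pi.single_eq_same, map_one]
  exact one_ne_zero

theorem isHomogeneousVec_single {b : ℕ} (a : Fin b → ℕ) (j : Fin b) :
    IsHomogeneousVec a (a j) (Pi.single j 1 : Fin b → MvPolynomial V k) := by
  classical
  intro l m hm
  by_cases h : l = j
  · subst h
    rw [Pi.single_eq_same, ← C_1, support_C, if_neg one_ne_zero, Finset.mem_singleton] at hm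
    rw [hm, map_zero, add_zero]
  · rw [Pi.single_eq_of_ne h, support_zero] at hm
    exact (Finset.notMem_empty _ hm).elim

/-- A minimal graded cover of a module with linear syzygies has its generators in a single degree,
and its kernel has linear syzygies. -/
theorem shift_eq_of_hasLinearSyzygies {b b' c τ : ℕ} {a' : Fin b' → ℕ}
    {K : Submodule (MvPolynomial V k) (Fin b → MvPolynomial V k)}
    (hK : ∀ s, HasLinearSyzygies k V s (subGrading K (vecGrading k V (Fin b) τ)))
    (p : (Fin b' → MvPolynomial V k) →ₗ[MvPolynomial V k] (Fin b → MvPolynomial V k))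
    (hp : LinearMap.range p = K)
    (hdeg : ∀ e x, IsHomogeneousVec a' e x → IsHomogeneousVec (fun _ => c) e (p x))
    (hmin : ∀ x ∈ LinearMap.ker p, ∀ j, constantCoeff (x j) = 0) :
    (∀ j, a' j = c + τ) ∧
      ∀ s, HasLinearSyzygies k V s (subGrading (LinearMap.ker p) (vecGrading k V (Fin b') 1)) := by
  classical
  have hKg : IsGraded k V (subGrading K (vecGrading k V (Fin b) τ)) :=
    (isGraded_vecGrading _ _).subGrading _
  obtain ⟨ι, _, g, hg, hspan, -⟩ := hK 1
  choose y hy using fun i => (hp.symm ▸ (g i).2 : (g i).1 ∈ LinearMap.range p)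
  have hrange : ∀ x, p x ∈ K := fun x => hp ▸ LinearMap.mem_range_self p x
  have hKτ : ∀ x ∈ K, ∀ l, ∀ m ∈ (x l).support, τ ≤ m.degree := by
    intro x hx l m hm
    obtain ⟨r, hr⟩ := exists_sum_smul_eq hspan ⟨x, hx⟩
    have hx' : x = ∑ i, r i • (g i).1 := by simpa using congrArg Subtype.val hr.symm
    rw [hx', Finset.sum_apply] at hm
    obtain ⟨i, -, m₁, -, m₂, hm₂, rfl⟩ := exists_of_mem_support_sum_mul hm
    have : m₂.degree = 0 + τ := by
      have := hg i l (mem_support_iff.1 hm₂)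
      rwa [weight_one_apply] at this
    rw [map_add]
    omega
  have hpe : ∀ j, IsHomogeneousVec (fun _ => c) (a' j) (p (Pi.single j 1)) := fun j =>
    hdeg _ _ (isHomogeneousVec_single a' j)
  -- By minimality `p` does not kill a basis vector, so its degree is at least c + τ by `hKτ`. If it
  -- were larger, the image would be a combination of the `g i` with coefficients of positive
  -- degree. Lifting that combination gives a kernel element with a nonzero constant term.
  have ha' : ∀ j, a' j = c + τ := by
    intro j
    have hne : p (Pi.single j 1) ≠ 0 := fun h =>
      constantCoeff_single_ne_zero j (hmin _ h j)
    obtain ⟨l, hl⟩ := Function.ne_iff.1 hne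
    obtain ⟨m, hm⟩ := Finset.nonempty_iff_ne_empty.2 (mt support_eq_empty.1 hl)
    have h₁ : c + m.degree = a' j := hpe j l m hm
    have h₂ := hKτ _ (hrange _) l m hm
    obtain ⟨n, hn⟩ : ∃ n, a' j = c + (n + τ) := ⟨m.degree - τ, by omega⟩
    have hmem : (⟨p (Pi.single j 1), hrange _⟩ : K) ∈
        subGrading K (vecGrading k V (Fin b) τ) n :=
      (isHomogeneousVec_const hn.symm _).1 (hpe j)
    obtain ⟨r, hr, hrs⟩ := hKg.exists_homogeneous_coeff hg hspan hmem
    by_contra hne'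
    have hn0 : n ≠ 0 := by rintro rfl; exact hne' (by omega)
    have hker : Pi.single j 1 - ∑ i, r i • y i ∈ LinearMap.ker p := by
      have hrs' : ∑ i, r i • (g i).1 = p (Pi.single j 1) := by
        simpa using congrArg Subtype.val hrs
      rw [LinearMap.mem_ker, map_sub, ← hrs', map_sum]
      simp only [map_smul, hy, sub_self]
    have h0 := hmin _ hker j
    rw [Pi.sub_apply, map_sub, Finset.sum_apply, map_sum, Finset.sum_eq_zero, sub_zero] at h0
    · exact constantCoeff_single_ne_zero j h0
    · intro i _
      rw [Pi.smul_apply, smul_eq_mul, map_mul,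
        constantCoeff_eq_zero_of_isHomogeneous (hr i) hn0, zero_mul]
  refine ⟨ha', fun s => ?_⟩
  have hker : LinearMap.ker (p.codRestrict K hrange) = LinearMap.ker p :=
    LinearMap.ker_codRestrict _ _ _
  have := HasLinearSyzygies.ker_of_minimal hKg hK (p.codRestrict K hrange) ?_ ?_
    (by rw [hker]; exact hmin) s
  · rwa [hker] at this
  · rintro ⟨x, hx⟩
    obtain ⟨z, rfl⟩ := hp.symm ▸ hx
    exact ⟨z, rfl⟩
  · intro j
    exact (isHomogeneousVec_const (by rw [ha' j]; omega) _).1 (hpe j)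

namespace MinimalGradedFreeResolution

variable {I : Ideal (MvPolynomial V k)} (F : MinimalGradedFreeResolution I)

theorem constantCoeff_ker_aug {x : Fin (F.rank 0) → MvPolynomial V k} (hx : F.aug x = 0)
    (l : Fin (F.rank 0)) : constantCoeff (x l) = 0 := by
  obtain ⟨y, rfl⟩ := (F.exact_aug x).1 hx
  exact F.minimal 0 y l

theorem constantCoeff_ker_d {i : ℕ} {x : Fin (F.rank (i + 1)) → MvPolynomial V k}
    (hx : F.d i x = 0) (l : Fin (F.rank (i + 1))) : constantCoeff (x l) = 0 := by
  obtain ⟨y, rfl⟩ := (F.exact_d i x).1 hx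
  exact F.minimal (i + 1) y l

/-- If `f` represents the image of e_j and `y` maps to 1, then e_j - f y lies in the kernel of the
augmentation, hence has zero constant terms. So `f` has nonzero constant term and, being
homogeneous, is a constant. -/
theorem exists_aug_single (j : Fin (F.rank 0)) :
    F.shift 0 j = 0 ∧ ∃ c : k, c ≠ 0 ∧ F.aug (Pi.single j 1) = Ideal.Quotient.mk I (C c) := by
  obtain ⟨f, hf, hfe⟩ := F.aug_homogeneous _ _ (isHomogeneousVec_single (F.shift 0) j)
  obtain ⟨y, hy⟩ := F.aug_surjective (Ideal.Quotient.mk I 1)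
  have hker : F.aug (Pi.single j 1 - f • y) = 0 := by
    rw [map_sub, map_smul, hy, ← hfe, sub_eq_zero]
    change _ = Ideal.Quotient.mk I (f * 1)
    rw [mul_one]
  have h0 := F.constantCoeff_ker_aug hker j
  have hc : constantCoeff f ≠ 0 := by
    intro hc
    rw [Pi.sub_apply, map_sub, Pi.smul_apply, smul_eq_mul, map_mul, hc, zero_mul, sub_zero] at h0
    exact constantCoeff_single_ne_zero j h0
  have hs : F.shift 0 j = 0 := by
    by_contra h
    exact hc (constantCoeff_eq_zero_of_isHomogeneous hf h)
  refine ⟨hs, constantCoeff f, hc, ?_⟩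
  rw [← hfe]
  rw [hs] at hf
  congr 1
  rw [← sub_eq_zero]
  refine eq_zero_of_isHomogeneous_zero (hf.sub (isHomogeneous_C _ _)) ?_
  rw [map_sub, constantCoeff_C, sub_self]

/-- Two basis vectors with images c and c' would give the kernel element c' e_j - c e_l, whose
coordinates include a unit. -/
theorem rank_zero (hI : I ≠ ⊤) : F.rank 0 = 1 := by
  have h1 : F.rank 0 ≠ 0 := by
    intro h0
    have : IsEmpty (Fin (F.rank 0)) := by rw [h0]; infer_instance
    obtain ⟨y, hy⟩ := F.aug_surjective (Ideal.Quotient.mk I 1)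
    rw [Subsingleton.elim y 0, map_zero, eq_comm, Ideal.Quotient.eq_zero_iff_mem] at hy
    exact hI ((Ideal.eq_top_iff_one I).2 hy)
  by_contra hne
  obtain ⟨j, l, hjl⟩ : ∃ j l : Fin (F.rank 0), j ≠ l :=
    ⟨⟨0, by omega⟩, ⟨1, by omega⟩, by simp⟩
  obtain ⟨-, c, hc, hcj⟩ := F.exists_aug_single j
  obtain ⟨-, c', hc', hcl⟩ := F.exists_aug_single l
  have hker : F.aug ((C c' : MvPolynomial V k) • Pi.single j 1 -
      (C c : MvPolynomial V k) • Pi.single l 1) = 0 := by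
    rw [map_sub, map_smul, map_smul, hcj, hcl, sub_eq_zero]
    change Ideal.Quotient.mk I (C c' * C c) = Ideal.Quotient.mk I (C c * C c')
    rw [mul_comm]
  have h0 := F.constantCoeff_ker_aug hker j
  rw [Pi.sub_apply, Pi.smul_apply, Pi.smul_apply, Pi.single_eq_same, Pi.single_eq_of_ne hjl,
    smul_zero, sub_zero, smul_eq_mul, mul_one, constantCoeff_C] at h0
  exact hc' h0

theorem mem_ker_aug [Unique (Fin (F.rank 0))] (x : Fin (F.rank 0) → MvPolynomial V k) :
    F.aug x = 0 ↔ x default ∈ I := by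
  classical
  obtain ⟨-, c, hc, hcj⟩ := F.exists_aug_single default
  rw [map_eq_sum_smul, Fintype.sum_unique, hcj]
  change Ideal.Quotient.mk I (x default * C c) = 0 ↔ _
  rw [Ideal.Quotient.eq_zero_iff_mem]
  exact Ideal.mul_unit_mem_iff_mem I ((isUnit_iff_ne_zero.2 hc).map C)

theorem hasLinearSyzygies_ker_aug {t : ℕ} (hI : HasLinearResolution t I) (hne : I ≠ ⊤) (s : ℕ) :
    HasLinearSyzygies k V s
      (subGrading (LinearMap.ker F.aug) (vecGrading k V (Fin (F.rank 0)) t)) := by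
  have hrank := F.rank_zero hne
  have : Unique (Fin (F.rank 0)) := by rw [hrank]; infer_instance
  have hmap : Submodule.map ((LinearEquiv.funUnique (Fin (F.rank 0)) (MvPolynomial V k)
      (MvPolynomial V k)).symm : MvPolynomial V k →ₗ[MvPolynomial V k] _) I =
      LinearMap.ker F.aug := by
    ext x
    rw [Submodule.mem_map, LinearMap.mem_ker, F.mem_ker_aug]
    constructor
    · rintro ⟨y, hy, rfl⟩
      exact hy
    · intro hx
      exact ⟨x default, hx, funext fun j => congrArg x (Subsingleton.elim default j)⟩
  exact HasLinearSyzygies.of_linearEquiv (𝒜 := subGrading I (polyGrading k V t))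
    ((LinearEquiv.funUnique (Fin (F.rank 0)) (MvPolynomial V k)
      (MvPolynomial V k)).symm.ofSubmodules I _ hmap) (by intro a ha j; exact ha) (hI s)

/-- The linearity of the next kernel is carried along because it is the input of the next induction
step. -/
theorem shift_succ {t : ℕ} (hI : HasLinearResolution t I) (hne : I ≠ ⊤) (i : ℕ) :
    (∀ j, F.shift (i + 1) j = t + i) ∧ ∀ s, HasLinearSyzygies k V s
      (subGrading (LinearMap.ker (F.d i)) (vecGrading k V (Fin (F.rank (i + 1))) 1)) := by
  induction i with
  | zero =>
    have h0 : F.shift 0 = fun _ => 0 := funext fun j => (F.exists_aug_single j).1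
    have := shift_eq_of_hasLinearSyzygies (c := 0) (a' := F.shift 1)
      (F.hasLinearSyzygies_ker_aug hI hne) (F.d 0) (LinearMap.exact_iff.1 F.exact_aug).symm
      (fun e x hx => h0 ▸ F.d_homogeneous 0 e x hx)
      (fun x hx j => F.constantCoeff_ker_d hx j)
    refine ⟨fun j => ?_, this.2⟩
    rw [this.1 j]
    omega
  | succ i ih =>
    have h0 : F.shift (i + 1) = fun _ => t + i := funext ih.1
    have := shift_eq_of_hasLinearSyzygies (c := t + i) (a' := F.shift (i + 1 + 1))
      ih.2 (F.d (i + 1)) (LinearMap.exact_iff.1 (F.exact_d i)).symm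
      (fun e x hx => h0 ▸ F.d_homogeneous (i + 1) e x hx)
      (fun x hx j => F.constantCoeff_ker_d hx j)
    refine ⟨fun j => ?_, this.2⟩
    rw [this.1 j]
    omega

theorem isLinear {t : ℕ} (hI : HasLinearResolution t I) (hne : I ≠ ⊤) : F.IsLinear t :=
  ⟨F.rank_zero hne, fun j => (F.exists_aug_single j).1, fun i => (F.shift_succ hI hne i).1⟩

end MinimalGradedFreeResolution

theorem HasLinearResolution.ne_top {I : Ideal (MvPolynomial V k)} {t : ℕ} (ht : t ≠ 0)
    (hI : HasLinearResolution t I) : I ≠ ⊤ := by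
  intro h
  obtain ⟨ι, _, g, hg, hspan, -⟩ := hI 1
  obtain ⟨r, hr⟩ := exists_sum_smul_eq hspan ⟨1, h ▸ trivial⟩
  have h1 : (1 : MvPolynomial V k) = ∑ i, r i • (g i).1 := by
    simpa using congrArg Subtype.val hr.symm
  have := congrArg constantCoeff h1
  rw [map_one, map_sum, Finset.sum_eq_zero] at this
  · exact one_ne_zero this
  · intro i _
    have hgi : ((g i).1).IsHomogeneous (0 + t) := hg i
    rw [smul_eq_mul, map_mul, constantCoeff_eq_zero_of_isHomogeneous hgi (by omega), mul_zero]

end Uniqueness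

/-! ### Length of a minimal resolution -/

section ProjectiveDimension

variable {k : Type u} [Field k] {V : Type v}

open MvPolynomial CategoryTheory

/-- A minimal cover of a projective module is an isomorphism. -/
theorem ker_eq_bot_of_projective {M : Type*} [AddCommGroup M] [Module (MvPolynomial V k) M]
    [Module.Projective (MvPolynomial V k) M] {b : ℕ}
    (q : (Fin b → MvPolynomial V k) →ₗ[MvPolynomial V k] M) (hq : Function.Surjective q)
    (hmin : ∀ x, q x = 0 → ∀ j, constantCoeff (x j) = 0) : LinearMap.ker q = ⊥ := by
  obtain ⟨s, hs⟩ := Module.projective_lifting_property q LinearMap.id hq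
  have hs' : ∀ m, q (s m) = m := fun m => DFunLike.congr_fun hs m
  -- The projector id - s q fixes the kernel and sends basis vectors into it, hence to vectors
  -- without constant terms. Each application raises the lower bound on degrees by one, so the
  -- kernel is zero.
  have hdeg : ∀ n, ∀ x, q x = 0 → ∀ j, ∀ m ∈ (x j).support, n ≤ m.degree := by
    intro n
    induction n with
    | zero => exact fun _ _ _ _ _ => Nat.zero_le _
    | succ n ih =>
      intro x hx j m hm
      have hπ : x = ∑ l, x l • (LinearMap.id - s ∘ₗ q :
          (Fin b → MvPolynomial V k) →ₗ[MvPolynomial V k] _) (Pi.single l 1) := by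
        rw [← map_eq_sum_smul]
        simp [hx]
      rw [hπ, Finset.sum_apply] at hm
      obtain ⟨l, -, m₁, hm₁, m₂, hm₂, rfl⟩ := exists_of_mem_support_sum_mul hm
      have h₁ := ih x hx l m₁ hm₁
      have h₂ : m₂ ≠ 0 := by
        rintro rfl
        refine mem_support_iff.1 hm₂ ?_
        rw [← constantCoeff_eq]
        exact hmin _ (by simp [hs']) j
      have h₃ : m₂.degree ≠ 0 := by rwa [Ne, Finsupp.degree_eq_zero_iff]
      rw [map_add]
      omega
  rw [LinearMap.ker_eq_bot']
  intro x hx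
  funext j
  rw [Pi.zero_apply, ← support_eq_empty, Finset.eq_empty_iff_forall_notMem]
  intro m hm
  have := hdeg (m.degree + 1) x hx j m hm
  omega

theorem hasProjectiveDimensionLT_one_iff {M : Type (max u v)} [AddCommGroup M]
    [Module (MvPolynomial V k) M] {b b' : ℕ}
    (q : (Fin b → MvPolynomial V k) →ₗ[MvPolynomial V k] M) (hq : Function.Surjective q)
    (d : (Fin b' → MvPolynomial V k) →ₗ[MvPolynomial V k] (Fin b → MvPolynomial V k))
    (hdq : LinearMap.range d = LinearMap.ker q)
    (hmin : ∀ x l, constantCoeff (d x l) = 0)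
    (hmin' : ∀ x, d x = 0 → ∀ l, constantCoeff (x l) = 0) :
    HasProjectiveDimensionLT (ModuleCat.of (MvPolynomial V k) M) 1 ↔ b' = 0 := by
  rw [← projective_iff_hasProjectiveDimensionLT_one, ← IsProjective.iff_projective]
  constructor
  · intro h
    have hker := ker_eq_bot_of_projective q hq fun x hx => by
      obtain ⟨y, rfl⟩ : x ∈ LinearMap.range d := hdq ▸ hx
      exact hmin y
    by_contra hb
    rw [hker, LinearMap.range_eq_bot] at hdq
    exact constantCoeff_single_ne_zero (k := k) (V := V) ⟨0, Nat.pos_of_ne_zero hb⟩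
      (hmin' _ (by rw [hdq]; rfl) _)
  · rintro rfl
    have hker : LinearMap.ker q = ⊥ := by
      rw [← hdq, LinearMap.range_eq_bot]
      exact Subsingleton.elim _ _
    exact Module.Projective.of_equiv (LinearEquiv.ofBijective q ⟨LinearMap.ker_eq_bot.1 hker, hq⟩)

theorem hasProjectiveDimensionLT_ker_iff {M : Type (max u v)} [AddCommGroup M]
    [Module (MvPolynomial V k) M] {b : ℕ}
    (q : (Fin b → MvPolynomial V k) →ₗ[MvPolynomial V k] M) (hq : Function.Surjective q) (n : ℕ) :
    HasProjectiveDimensionLT (ModuleCat.of (MvPolynomial V k) M) (n + 2) ↔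
      HasProjectiveDimensionLT (ModuleCat.of (MvPolynomial V k) (LinearMap.ker q)) (n + 1) :=
  (LinearMap.shortExact_shortComplexKer hq).hasProjectiveDimensionLT_X₃_iff n
    ((IsProjective.iff_projective (R := MvPolynomial V k) (Fin b → MvPolynomial V k)).1 inferInstance)

namespace MinimalGradedFreeResolution

variable {I : Ideal (MvPolynomial V k)} (F : MinimalGradedFreeResolution I)

/-- Dimension shifting reduces to `n = 0`, where the image of `d i`, minimally covered by F_{i+1},
is projective exactly when F_{i+2} vanishes. -/
theorem hasProjectiveDimensionLT_range_d (n i : ℕ) :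
    HasProjectiveDimensionLT (ModuleCat.of (MvPolynomial V k) (LinearMap.range (F.d i))) (n + 1) ↔
      F.rank (i + n + 2) = 0 := by
  induction n generalizing i with
  | zero =>
    refine hasProjectiveDimensionLT_one_iff (F.d i).rangeRestrict
      (LinearMap.surjective_rangeRestrict _) (F.d (i + 1)) ?_ (F.minimal (i + 1))
      (fun x hx => F.constantCoeff_ker_d hx)
    rw [LinearMap.ker_rangeRestrict]
    exact (LinearMap.exact_iff.1 (F.exact_d i)).symm
  | succ n ih =>
    rw [hasProjectiveDimensionLT_ker_iff (F.d i).rangeRestrict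
      (LinearMap.surjective_rangeRestrict _), LinearMap.ker_rangeRestrict,
      LinearMap.exact_iff.1 (F.exact_d i), ih]
    rw [show i + 1 + n + 2 = i + (n + 1) + 2 by omega]

theorem rank_ne_zero_iff (hI : I ≠ ⊤) (i : ℕ) :
    F.rank i ≠ 0 ↔ (i : WithBot ℕ∞) ≤ projectiveDimension
      (ModuleCat.of (MvPolynomial V k) (MvPolynomial V k ⧸ I)) := by
  rw [← not_lt, projectiveDimension_lt_iff, not_iff_not]
  match i with
  | 0 =>
    rw [F.rank_zero hI, hasProjectiveDimensionLT_zero_iff_isZero, ModuleCat.isZero_of_iff_subsingleton,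
      Ideal.Quotient.subsingleton_iff]
    simp [hI]
  | 1 =>
    exact (hasProjectiveDimensionLT_one_iff F.aug F.aug_surjective (F.d 0)
      (LinearMap.exact_iff.1 F.exact_aug).symm (F.minimal 0)
      (fun x hx => F.constantCoeff_ker_d hx)).symm
  | n + 2 =>
    rw [hasProjectiveDimensionLT_ker_iff F.aug F.aug_surjective,
      LinearMap.exact_iff.1 F.exact_aug, F.hasProjectiveDimensionLT_range_d]
    rw [zero_add]

end MinimalGradedFreeResolution

end ProjectiveDimension

/-! ### Generating functions of monomials by support -/

section Counting

variable {V : Type v} [Fintype V]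

open Classical in
/-- The number of monomials of degree `e` whose support satisfies `P`. -/
noncomputable def monomialCount (P : Finset V → Prop) (e : ℕ) : ℕ :=
  ((Finset.finsuppAntidiag (Finset.univ : Finset V) e).filter (fun m => P m.support)).card

section

open PowerSeries

/-- Each variable in `s` occurs with positive exponent and contributes X/(1-X), which is `X * mk 1`.
-/
theorem monomialCount_eq (s : Finset V) (e : ℕ) :
    (monomialCount (fun t => t = s) e : ℤ) = coeff e ((X * mk 1 : ℤ⟦X⟧) ^ s.card) := by
  classical
  have hc : ∀ n, coeff n (X * mk 1 : ℤ⟦X⟧) = if n = 0 then 0 else 1 := by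
    intro n
    cases n with
    | zero => simp
    | succ n => rw [coeff_succ_X_mul, coeff_mk]; simp
  rw [← Finset.prod_const, coeff_prod, monomialCount, Finset.card_eq_sum_ones, Nat.cast_sum,
    Finset.sum_filter]
  simp only [hc]
  have hsub : Finset.finsuppAntidiag s e ⊆ Finset.finsuppAntidiag Finset.univ e :=
    Finset.finsuppAntidiag_mono (Finset.subset_univ _) e
  rw [← Finset.sum_subset hsub]
  · refine Finset.sum_congr rfl fun m hm => ?_
    obtain ⟨-, hms⟩ := Finset.mem_finsuppAntidiag.1 hm
    split_ifs with h
    · rw [Nat.cast_one, Finset.prod_eq_one]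
      intro i hi
      rw [← h, Finsupp.mem_support_iff] at hi
      rw [if_neg hi]
    · obtain ⟨i, hi, him⟩ : ∃ i ∈ s, i ∉ m.support := by
        by_contra hcon
        push Not at hcon
        exact h (Finset.Subset.antisymm hms hcon)
      symm
      refine Finset.prod_eq_zero hi ?_
      rw [if_pos (Finsupp.notMem_support_iff.1 him)]
  · intro m hm hms
    rw [if_neg]
    intro h
    obtain ⟨hsum, -⟩ := Finset.mem_finsuppAntidiag.1 hm
    refine hms (Finset.mem_finsuppAntidiag.2 ⟨?_, h.le⟩)
    rw [← hsum]
    refine Finset.sum_subset (Finset.subset_univ _) fun i _ hi => ?_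
    rwa [← h, Finsupp.notMem_support_iff] at hi

open Classical in
theorem monomialCount_eq_sum (P : Finset V → Prop) (e : ℕ) :
    monomialCount P e = ∑ s with P s, monomialCount (fun t => t = s) e := by
  rw [monomialCount, Finset.card_eq_sum_card_fiberwise (f := fun m => m.support)
    (t := Finset.univ.filter P) (fun m hm => by simpa using (Finset.mem_filter.1 hm).2)]
  refine Finset.sum_congr rfl fun s hs => ?_
  rw [monomialCount]
  congr 1
  ext m
  simp only [Finset.mem_filter] at hs ⊢
  constructor
  · rintro ⟨⟨h, -⟩, h'⟩
    exact ⟨h, h'⟩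
  · rintro ⟨h, rfl⟩
    exact ⟨⟨h, hs.2⟩, rfl⟩

open Classical in
theorem mk_monomialCount_mul (P : Finset V → Prop) :
    mk (fun e => (monomialCount P e : ℤ)) * (1 - X) ^ Fintype.card V =
      ∑ s with P s, X ^ s.card * (1 - X) ^ (Fintype.card V - s.card) := by
  have h : mk (fun e => (monomialCount P e : ℤ)) = ∑ s with P s, (X * mk 1 : ℤ⟦X⟧) ^ s.card := by
    ext e
    rw [coeff_mk, monomialCount_eq_sum, map_sum, Nat.cast_sum]
    simp only [monomialCount_eq]
  rw [h, Finset.sum_mul]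
  refine Finset.sum_congr rfl fun s _ => ?_
  have hs : Fintype.card V = s.card + (Fintype.card V - s.card) := by
    have := s.card_le_univ
    omega
  conv_lhs => rw [hs, pow_add]
  rw [← mul_assoc, ← mul_pow, mul_assoc, mk_one_mul_one_sub_eq_one, mul_one]

/-- The sum over all subsets is (X + (1-X))^n by the binomial theorem. -/
theorem mk_monomialCount_true_mul :
    mk (fun e => (monomialCount (fun _ : Finset V => True) e : ℤ)) * (1 - X) ^ Fintype.card V
      = 1 := by
  classical
  rw [mk_monomialCount_mul]
  simp only [Finset.filter_true]
  rw [Fintype.sum_pow_mul_eq_add_pow, add_sub_cancel, one_pow]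

theorem monomialCount_add_not (P : Finset V → Prop) (e : ℕ) :
    monomialCount P e + monomialCount (fun s => ¬ P s) e =
      monomialCount (fun _ : Finset V => True) e := by
  classical
  simp only [monomialCount, Finset.filter_true]
  convert Finset.card_filter_add_card_filter_not
    (s := Finset.finsuppAntidiag (Finset.univ : Finset V) e) (fun m => P m.support)

end

theorem dimAddOne_le (Δ : AbstractSimplicialComplex V) : dimAddOne Δ ≤ Fintype.card V :=
  Finset.sup_le fun s _ => s.card_le_univ

open Polynomial in
theorem sum_allFaces (Δ : AbstractSimplicialComplex V) :
    ∑ s ∈ allFaces Δ, (X : ℤ[X]) ^ s.card * (1 - X) ^ (Fintype.card V - s.card) =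
      (1 - X) ^ (Fintype.card V - dimAddOne Δ) * hPolynomial Δ := by
  have hle : ∀ s ∈ allFaces Δ, s.card ≤ dimAddOne Δ := fun s hs =>
    Finset.le_sup (f := Finset.card) hs
  rw [hPolynomial, ← Finset.sum_fiberwise_of_maps_to (g := Finset.card)
    (t := Finset.range (dimAddOne Δ + 1))
    (fun s hs => Finset.mem_range.2 (Nat.lt_succ_of_le (hle s hs))), Finset.mul_sum]
  refine Finset.sum_congr rfl fun i hi => ?_
  have hi' := Finset.mem_range.1 hi
  have hd := dimAddOne_le Δ
  rw [Finset.sum_congr rfl (g := fun _ => (X : ℤ[X]) ^ i * (1 - X) ^ (Fintype.card V - i))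
    (fun s hs => by rw [(Finset.mem_filter.1 hs).2]), Finset.sum_const, nsmul_eq_mul, numFaces,
    show Fintype.card V - i = (Fintype.card V - dimAddOne Δ) + (dimAddOne Δ - i) by omega, pow_add]
  simp only [map_natCast]
  ring

open Polynomial in
theorem coeff_one_sub_X_pow (m a : ℕ) :
    ((1 - X : ℤ[X]) ^ m).coeff a = (-1) ^ a * (m.choose a : ℤ) := by
  induction m generalizing a with
  | zero =>
    cases a with
    | zero => simp
    | succ a => simp [coeff_one]
  | succ m ih =>
    rw [pow_succ', sub_mul, one_mul, coeff_sub]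
    cases a with
    | zero => simp [ih]
    | succ a =>
      rw [coeff_X_mul, ih, ih, Nat.choose_succ_succ]
      push_cast
      ring

theorem coeff_one_sub_X_pow_mul_hPolynomial (Δ : AbstractSimplicialComplex V) (m j : ℕ) :
    ((1 - Polynomial.X) ^ m * hPolynomial Δ).coeff j =
      ∑ l ∈ Finset.range (j + 1), (-1 : ℤ) ^ l * hVector Δ (j - l) * (m.choose l : ℤ) := by
  rw [Polynomial.coeff_mul, Finset.Nat.sum_antidiagonal_eq_sum_range_succ_mk]
  refine Finset.sum_congr rfl fun l _ => ?_
  rw [coeff_one_sub_X_pow, hVector]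
  ring

-- The numerator of the Hilbert series of the Stanley-Reisner ideal: all monomials contribute 1, and
-- those supported on faces contribute (1-X)^{n-d} h(X).
open PowerSeries in
theorem mk_monomialCount_nonface_mul (Δ : AbstractSimplicialComplex V) :
    mk (fun e => (monomialCount (fun s => ¬ IsFace Δ s) e : ℤ)) * (1 - X) ^ Fintype.card V =
      1 - (((1 - Polynomial.X) ^ (Fintype.card V - dimAddOne Δ) * hPolynomial Δ :
        Polynomial ℤ) : ℤ⟦X⟧) := by
  classical
  have h : mk (fun e => (monomialCount (fun s => ¬ IsFace Δ s) e : ℤ)) =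
      mk (fun e => (monomialCount (fun _ : Finset V => True) e : ℤ)) -
        mk (fun e => (monomialCount (IsFace Δ) e : ℤ)) := by
    ext e
    rw [map_sub, coeff_mk, coeff_mk, coeff_mk, ← monomialCount_add_not (IsFace Δ) e]
    push_cast
    ring
  rw [h, sub_mul, mk_monomialCount_true_mul, mk_monomialCount_mul, ← sum_allFaces, allFaces]
  congr 1
  rw [← Polynomial.coeToPowerSeries.ringHom_apply, map_sum]
  refine Finset.sum_congr (by congr) fun s _ => ?_
  simp

end Counting

/-! ### Ranks from the Hilbert series -/

section HilbertSeries

variable {k : Type u} [Field k] {V : Type v}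

open MvPolynomial

/-- The elements of a submodule with coordinates homogeneous of degree `n`. -/
noncomputable def homPart {b : ℕ}
    (K : Submodule (MvPolynomial V k) (Fin b → MvPolynomial V k)) (n : ℕ) :
    Submodule k (Fin b → MvPolynomial V k) :=
  K.restrictScalars k ⊓ Submodule.pi Set.univ fun _ => homogeneousSubmodule V k n

theorem mem_homPart {b : ℕ} {K : Submodule (MvPolynomial V k) (Fin b → MvPolynomial V k)} {n : ℕ}
    {x : Fin b → MvPolynomial V k} :
    x ∈ homPart K n ↔ x ∈ K ∧ ∀ l, (x l).IsHomogeneous n := by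
  rw [homPart, Submodule.mem_inf, Submodule.restrictScalars_mem, Submodule.mem_pi]
  exact and_congr_right fun _ => ⟨fun h l => h l trivial, fun h l _ => h l⟩

theorem homogeneousSubmodule_eq_restrictSupport (n : ℕ) : homogeneousSubmodule V k n =
    restrictSupport k {m : V →₀ ℕ | m.degree = n ∧ True} := by
  rw [homogeneousSubmodule_eq_finsupp_supported]
  simp only [and_true]
  rfl

theorem MinimalGradedFreeResolution.homPart_ker_d_zero {I : Ideal (MvPolynomial V k)}
    (F : MinimalGradedFreeResolution I) (i : ℕ) : homPart (LinearMap.ker (F.d i)) 0 = ⊥ := by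
  rw [eq_bot_iff]
  intro x hx
  rw [mem_homPart] at hx
  rw [Submodule.mem_bot]
  funext l
  exact eq_zero_of_isHomogeneous_zero (hx.2 l) (F.constantCoeff_ker_d hx.1 l)

variable [Fintype V]

open Classical in
theorem mem_finsuppAntidiag_univ {m : V →₀ ℕ} {n : ℕ} :
    m ∈ Finset.finsuppAntidiag (Finset.univ : Finset V) n ↔ m.degree = n := by
  rw [Finset.mem_finsuppAntidiag, Finsupp.degree_eq_sum]
  exact and_iff_left (Finset.subset_univ _)

theorem monomialCount_eq_zero {P : Finset V → Prop} {n : ℕ}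
    (h : ∀ m : V →₀ ℕ, m.degree = n → ¬ P m.support) : monomialCount P n = 0 := by
  classical
  rw [monomialCount, Finset.card_eq_zero, Finset.filter_eq_empty_iff]
  exact fun m hm => h m (mem_finsuppAntidiag_univ.1 hm)

theorem finrank_restrictSupport (P : Finset V → Prop) (n : ℕ) :
    Module.finrank k (restrictSupport k {m : V →₀ ℕ | m.degree = n ∧ P m.support}) =
      monomialCount P n := by
  classical
  have h : {m : V →₀ ℕ | m.degree = n ∧ P m.support} =
      ((Finset.finsuppAntidiag (Finset.univ : Finset V) n).filter
        (fun m => P m.support) : Finset (V →₀ ℕ)) := by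
    ext m
    simp only [Finset.coe_filter, Set.mem_ofPred_eq, mem_finsuppAntidiag_univ]
  rw [h, Module.finrank_eq_card_basis (basisRestrictSupport k _), monomialCount]
  simp

theorem finrank_homogeneousSubmodule (n : ℕ) : Module.finrank k (homogeneousSubmodule V k n) =
    monomialCount (fun _ : Finset V => True) n := by
  rw [homogeneousSubmodule_eq_restrictSupport]
  exact finrank_restrictSupport (fun _ => True) n

instance finiteDimensional_homogeneousSubmodule (n : ℕ) :
    FiniteDimensional k (homogeneousSubmodule V k n) := by
  rw [homogeneousSubmodule_eq_restrictSupport]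
  have hfin : {m : V →₀ ℕ | m.degree = n ∧ True}.Finite :=
    (Finsupp.finite_of_degree_le n).subset fun m hm => hm.1.le
  have := hfin.to_subtype
  exact Module.Finite.of_basis (basisRestrictSupport k _)

/-- Rank-nullity for `p` restricted to vectors of degree `n`; this restriction is onto the part of
degree `n + τ` because homogeneous elements have homogeneous coefficients. -/
theorem finrank_homPart_add {b b' τ : ℕ}
    {K : Submodule (MvPolynomial V k) (Fin b → MvPolynomial V k)}
    (p : (Fin b' → MvPolynomial V k) →ₗ[MvPolynomial V k] (Fin b → MvPolynomial V k))
    (hp : LinearMap.range p = K) (hdeg : ∀ j l, (p (Pi.single j 1) l).IsHomogeneous τ) (n : ℕ) :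
    Module.finrank k (homPart K (n + τ)) + Module.finrank k (homPart (LinearMap.ker p) n) =
      b' * monomialCount (fun _ : Finset V => True) n := by
  let ι : (Fin b' → homogeneousSubmodule V k n) →ₗ[k] (Fin b' → MvPolynomial V k) :=
    (homogeneousSubmodule V k n).subtype.compLeft (Fin b')
  have hι : Function.Injective ι := fun x y h => funext fun j => Subtype.ext (congrFun h j)
  let T : (Fin b' → homogeneousSubmodule V k n) →ₗ[k] (Fin b → MvPolynomial V k) :=
    p.restrictScalars k ∘ₗ ι
  have hT : ∀ x, T x = p (ι x) := fun x => rfl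
  have hrangeT : LinearMap.range T = homPart K (n + τ) := by
    ext y
    rw [mem_homPart, LinearMap.mem_range]
    constructor
    · rintro ⟨x, rfl⟩
      rw [hT]
      refine ⟨hp ▸ LinearMap.mem_range_self p _, fun l => ?_⟩
      rw [map_eq_sum_smul, Finset.sum_apply]
      exact IsHomogeneous.sum _ _ _ fun j _ => (x j).2.mul (hdeg j l)
    · rintro ⟨hy, hyl⟩
      have hmem : ∀ x, p x ∈ K := fun x => hp ▸ LinearMap.mem_range_self p x
      have hspan : Submodule.span (MvPolynomial V k) (Set.range fun j : Fin b' =>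
          (⟨p (Pi.single j 1), hmem _⟩ : K)) = ⊤ := by
        rw [eq_top_iff]
        rintro ⟨z, hz⟩ -
        obtain ⟨x, rfl⟩ := hp.symm ▸ hz
        have : (⟨p x, hz⟩ : K) = ∑ j, x j • (⟨p (Pi.single j 1), hmem _⟩ : K) := by
          apply Subtype.ext
          change p x = _
          rw [map_eq_sum_smul]
          simp
        rw [this]
        exact Submodule.sum_mem _ fun j _ => Submodule.smul_mem _ _
          (Submodule.subset_span ⟨j, rfl⟩)
      obtain ⟨r, hr, hrs⟩ := ((isGraded_vecGrading (k := k) (V := V) (Fin b) τ).subGrading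
        K).exists_homogeneous_coeff (e := n) (m := ⟨y, hy⟩)
        (fun j l => by simpa using hdeg j l) hspan hyl
      refine ⟨fun j => ⟨r j, hr j⟩, ?_⟩
      rw [hT, map_eq_sum_smul]
      change ∑ j, r j • p (Pi.single j 1) = y
      simpa using congrArg Subtype.val hrs
  have hkerT : (LinearMap.ker T).map ι = homPart (LinearMap.ker p) n := by
    ext y
    rw [mem_homPart, Submodule.mem_map]
    constructor
    · rintro ⟨x, hx, rfl⟩
      exact ⟨hx, fun l => (x l).2⟩
    · rintro ⟨hy, hyl⟩
      exact ⟨fun j => ⟨y j, hyl j⟩, hy, rfl⟩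
  have h := LinearMap.finrank_range_add_finrank_ker T
  rw [hrangeT, (Submodule.equivMapOfInjective ι hι (LinearMap.ker T)).finrank_eq, hkerT,
    Module.finrank_pi_fintype] at h
  rw [h]
  simp [finrank_homogeneousSubmodule]

namespace MinimalGradedFreeResolution

variable {I : Ideal (MvPolynomial V k)} (F : MinimalGradedFreeResolution I)

/-- The Hilbert function of the syzygies, normalised so that generators have degree zero. -/
noncomputable def syzygyCount (t : ℕ) : ℕ → ℕ → ℕ
  | 0, e => Module.finrank k (homPart (LinearMap.ker F.aug) (e + t))
  | i + 1, e => Module.finrank k (homPart (LinearMap.ker (F.d i)) (e + 1))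

theorem syzygyCount_add {t : ℕ} (hF : F.IsLinear t) (i e : ℕ) :
    F.syzygyCount t i e + Module.finrank k (homPart (LinearMap.ker (F.d i)) e) =
      F.rank (i + 1) * monomialCount (fun _ : Finset V => True) e := by
  cases i with
  | zero =>
    refine finrank_homPart_add (F.d 0) (LinearMap.exact_iff.1 F.exact_aug).symm (fun j => ?_) e
    have h0 : F.shift 0 = fun _ => 0 := funext hF.2.1
    have h := F.d_homogeneous 0 _ _ (isHomogeneousVec_single (F.shift 1) j)
    rw [h0, hF.2.2 0 j] at h
    exact (isHomogeneousVec_const (by omega) _).1 h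
  | succ i =>
    refine finrank_homPart_add (F.d (i + 1)) (LinearMap.exact_iff.1 (F.exact_d i)).symm
      (fun j => ?_) e
    have h0 : F.shift (i + 1) = fun _ => t + i := funext (hF.2.2 i)
    have h := F.d_homogeneous (i + 1) _ _ (isHomogeneousVec_single (F.shift (i + 1 + 1)) j)
    rw [h0, hF.2.2 (i + 1) j] at h
    exact (isHomogeneousVec_const (by omega) _).1 h

/-- Comparing coefficients in B_i + X B_{i+1} = β_i, the constant term of B_i is β_i, and each
higher coefficient is minus the preceding coefficient of B_{i+1}. Iterating from B_0 produces the
sign. -/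
theorem rank_succ_eq_coeff {t : ℕ} (hF : F.IsLinear t) (i : ℕ) :
    (F.rank (i + 1) : ℤ) = (-1) ^ i * PowerSeries.coeff i
      (PowerSeries.mk (fun e => (F.syzygyCount t 0 e : ℤ)) *
        (1 - PowerSeries.X) ^ Fintype.card V) := by
  set B : ℕ → PowerSeries ℤ := fun i => PowerSeries.mk (fun e => (F.syzygyCount t i e : ℤ)) *
    (1 - PowerSeries.X) ^ Fintype.card V with hB
  have hrel : ∀ i, B i + PowerSeries.X * B (i + 1) = PowerSeries.C (F.rank (i + 1) : ℤ) := by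
    intro i
    have h : PowerSeries.mk (fun e => (F.syzygyCount t i e : ℤ)) +
        PowerSeries.X * PowerSeries.mk (fun e => (F.syzygyCount t (i + 1) e : ℤ)) =
        PowerSeries.C (F.rank (i + 1) : ℤ) *
          PowerSeries.mk (fun e => (monomialCount (fun _ : Finset V => True) e : ℤ)) := by
      ext e
      have := F.syzygyCount_add hF i e
      rw [map_add, PowerSeries.coeff_C_mul, PowerSeries.coeff_mk, PowerSeries.coeff_mk,
        ← Nat.cast_mul, ← this, Nat.cast_add]
      congr 1
      cases e with
      -- The normalised count of later syzygies starts in degree one; nothing is lost, since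
      -- minimality excludes constant syzygies.
      | zero => rw [homPart_ker_d_zero]; simp
      | succ e => rw [PowerSeries.coeff_succ_X_mul, PowerSeries.coeff_mk]; rfl
    rw [hB]
    simp only
    rw [← mul_assoc, ← add_mul, h, mul_assoc, mk_monomialCount_true_mul, mul_one]
  have hcoeff : ∀ m i, (F.rank (i + m + 1) : ℤ) = (-1) ^ m * PowerSeries.coeff m (B i) := by
    intro m
    induction m with
    | zero =>
      intro i
      have := congrArg (PowerSeries.coeff 0) (hrel i)
      rw [map_add, PowerSeries.coeff_zero_X_mul, PowerSeries.coeff_zero_C, add_zero] at this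
      rw [this, pow_zero, one_mul, add_zero]
    | succ m ih =>
      intro i
      have := congrArg (PowerSeries.coeff (m + 1)) (hrel i)
      rw [map_add, PowerSeries.coeff_succ_X_mul, PowerSeries.coeff_C, if_neg (by omega)] at this
      have h := ih (i + 1)
      rw [show i + 1 + m + 1 = i + (m + 1) + 1 by omega] at h
      rw [h, eq_neg_of_add_eq_zero_left this]
      ring
  have := hcoeff i 0
  rwa [zero_add] at this

end MinimalGradedFreeResolution

end HilbertSeries

/-! ### Application to chordal clique complexes -/

section Chordal

variable {k : Type u} [Field k] {V : Type v}

open MvPolynomial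

theorem mem_stanleyReisnerIdeal_cliqueComplex (G : SimpleGraph V) (f : MvPolynomial V k) :
    f ∈ stanleyReisnerIdeal k (cliqueComplex G) ↔
      ∀ m ∈ f.support, ¬ IsFace (cliqueComplex G) m.support := by
  classical
  rw [stanleyReisnerIdeal_cliqueComplex, nonedgeIdeal_eq, mem_ideal_span_monomial_image]
  refine forall₂_congr fun m _ => ?_
  rw [isFace_cliqueComplex, SimpleGraph.IsClique, Set.Pairwise]
  push Not
  constructor
  · rintro ⟨_, ⟨a, -, b, -, hab, h, rfl⟩, hle⟩
    refine ⟨a, ?_, b, ?_, hab, h⟩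
    · have := hle a
      simp only [Finsupp.add_apply, Finsupp.single_eq_same] at this
      rw [Finset.mem_coe, Finsupp.mem_support_iff]
      omega
    · have := hle b
      simp only [Finsupp.add_apply, Finsupp.single_eq_same] at this
      rw [Finset.mem_coe, Finsupp.mem_support_iff]
      omega
  · rintro ⟨a, ha, b, hb, hab, h⟩
    rw [Finset.mem_coe, Finsupp.mem_support_iff] at ha hb
    refine ⟨_, ⟨a, trivial, b, trivial, hab, h, rfl⟩, fun i => ?_⟩
    rw [Finsupp.add_apply, Finsupp.single_apply, Finsupp.single_apply]
    split_ifs with h₁ h₂ h₂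
    · exact (hab (h₁.trans h₂.symm)).elim
    · subst h₁; omega
    · subst h₂; omega
    · exact Nat.zero_le _

variable [Fintype V]

theorem IsChordal.hasLinearResolution {G : SimpleGraph V} (hG : IsChordal G) :
    HasLinearResolution 2 (stanleyReisnerIdeal k (cliqueComplex G)) := by
  rw [stanleyReisnerIdeal_cliqueComplex, ← Finset.coe_univ]
  exact hasLinearResolution_nonedgeIdeal G hG.exists_simplicial Finset.univ

theorem finrank_homPart_ker_aug {G : SimpleGraph V}
    (F : MinimalGradedFreeResolution (stanleyReisnerIdeal k (cliqueComplex G)))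
    (hne : stanleyReisnerIdeal k (cliqueComplex G) ≠ ⊤) (n : ℕ) :
    Module.finrank k (homPart (LinearMap.ker F.aug) n) =
      monomialCount (fun s => ¬ IsFace (cliqueComplex G) s) n := by
  have hrank := F.rank_zero hne
  have : Unique (Fin (F.rank 0)) := by rw [hrank]; infer_instance
  rw [← finrank_restrictSupport (k := k)]
  refine ((LinearEquiv.funUnique (Fin (F.rank 0)) k (MvPolynomial V k)).ofSubmodules _ _
    ?_).finrank_eq
  ext f
  rw [Submodule.mem_map, mem_restrictSupport_iff]
  constructor
  · rintro ⟨x, hx, rfl⟩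
    rw [mem_homPart, LinearMap.mem_ker, F.mem_ker_aug,
      mem_stanleyReisnerIdeal_cliqueComplex] at hx
    intro m hm
    refine ⟨?_, hx.1 m hm⟩
    rw [← weight_one_apply]
    exact hx.2 default (mem_support_iff.1 hm)
  · intro hf
    refine ⟨fun _ => f, ?_, rfl⟩
    rw [mem_homPart, LinearMap.mem_ker, F.mem_ker_aug, mem_stanleyReisnerIdeal_cliqueComplex]
    refine ⟨fun m hm => (hf hm).2, fun _ m hm => ?_⟩
    rw [weight_one_apply]
    exact (hf (mem_support_iff.2 hm)).1

/-- The support of such a monomial has at most one vertex. This makes the shift by two in the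
Hilbert series lossless. -/
theorem monomialCount_nonface_of_lt_two (G : SimpleGraph V) {e : ℕ} (he : e < 2) :
    monomialCount (fun s => ¬ IsFace (cliqueComplex G) s) e = 0 := by
  classical
  refine monomialCount_eq_zero fun m hm => ?_
  rw [not_not, isFace_cliqueComplex]
  intro a ha b hb hab
  rw [Finset.mem_coe, Finsupp.mem_support_iff] at ha hb
  have h : ∑ i ∈ {a, b}, m i ≤ m.degree := by
    rw [Finsupp.degree_eq_sum]
    exact Finset.sum_le_sum_of_subset (Finset.subset_univ _)
  rw [Finset.sum_pair hab] at h
  omega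

theorem rank_succ_eq {G : SimpleGraph V}
    (F : MinimalGradedFreeResolution (stanleyReisnerIdeal k (cliqueComplex G)))
    (hne : stanleyReisnerIdeal k (cliqueComplex G) ≠ ⊤) (hF : F.IsLinear 2) (i : ℕ) :
    (F.rank (i + 1) : ℤ) = ∑ l ∈ Finset.range (2 + i + 1),
      (-1 : ℤ) ^ (l + i + 1) * hVector (cliqueComplex G) (2 + i - l) *
        ((Fintype.card V - dimAddOne (cliqueComplex G)).choose l : ℤ) := by
  have hX : PowerSeries.X ^ 2 * PowerSeries.mk (fun e => (F.syzygyCount 2 0 e : ℤ)) =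
      PowerSeries.mk
        (fun e => (monomialCount (fun s => ¬ IsFace (cliqueComplex G) s) e : ℤ)) := by
    ext e
    rw [PowerSeries.coeff_X_pow_mul']
    split_ifs with he
    · rw [PowerSeries.coeff_mk, PowerSeries.coeff_mk, MinimalGradedFreeResolution.syzygyCount,
        finrank_homPart_ker_aug F hne, Nat.sub_add_cancel he]
    · rw [PowerSeries.coeff_mk, monomialCount_nonface_of_lt_two G (by omega), Nat.cast_zero]
  have h := mk_monomialCount_nonface_mul (cliqueComplex G)
  rw [← hX, mul_assoc] at h
  have hc := congrArg (PowerSeries.coeff (2 + i)) h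
  -- The coefficient is taken in the positive degree i + 2, so the summand 1 drops out; the minus
  -- sign that remains turns (-1)^{l+i} into (-1)^{l+i+1}.
  rw [add_comm 2 i, PowerSeries.coeff_X_pow_mul, map_sub, PowerSeries.coeff_one,
    if_neg (by omega), zero_sub, Polynomial.coeff_coe, coeff_one_sub_X_pow_mul_hPolynomial] at hc
  rw [F.rank_succ_eq_coeff hF, hc, add_comm 2 i, mul_neg, Finset.mul_sum, ← Finset.sum_neg_distrib]
  refine Finset.sum_congr rfl fun l _ => ?_
  ring

end Chordal

end ChordalBetti

theorem mainTheorem5 {k : Type*} [Field k] {V : Type*} [Fintype V] (G : SimpleGraph V)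
    (hG : ChordalBetti.IsChordal G) :
    Nonempty (ChordalBetti.MinimalGradedFreeResolution
      (ChordalBetti.stanleyReisnerIdeal k (ChordalBetti.cliqueComplex G))) ∧
    ∀ F : ChordalBetti.MinimalGradedFreeResolution
        (ChordalBetti.stanleyReisnerIdeal k (ChordalBetti.cliqueComplex G)),
      F.IsLinear 2 ∧
      (∀ i : ℕ, F.rank i ≠ 0 ↔
        (i : WithBot ℕ∞) ≤ CategoryTheory.projectiveDimension
          (ModuleCat.of (MvPolynomial V k)
            (ChordalBetti.StanleyReisnerRing k (ChordalBetti.cliqueComplex G)))) ∧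
      ∀ i : ℕ, (F.rank (i + 1) : ℤ) =
        ∑ l ∈ Finset.range (2 + i + 1),
          (-1 : ℤ) ^ (l + i + 1) *
            ChordalBetti.hVector (ChordalBetti.cliqueComplex G) (2 + i - l) *
            ((Fintype.card V -
              ChordalBetti.dimAddOne (ChordalBetti.cliqueComplex G)).choose l : ℤ) := by
  have hI := hG.hasLinearResolution (k := k)
  have hne := hI.ne_top two_ne_zero
  refine ⟨⟨ChordalBetti.linearResolution two_ne_zero hI⟩, fun F => ?_⟩
  have hF := F.isLinear hI hne
  exact ⟨hF, F.rank_ne_zero_iff hne, ChordalBetti.rank_succ_eq F hne hF⟩
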